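/- Let $\pi:\mathbb R\to(0,\infty)$ be a differentiable, everywhere positive probability density with mean $0$ that is symmetric, $\pi(-x)=\pi(x)$, and suppose that (1) $(\ln\pi)'$ is monotonically decreasing (not necessarily strictly) and (2) $\lim_{x\to-\infty}(\ln\pi)'(x)=+\infty$. Let $a_1,\dots,a_m$ be alternatives. $\mathrm{RUM}(\pi)$ is the model with parameter space $\Theta=\{\theta\in\mathbb R^m:\theta_m=0\}$ in which a ranking is generated by drawing independent utilities $u_i$ with densities $u\mapsto\pi(u-\theta_i)$ and ranking the alternatives by decreasing utility; let $p_{ij}(\theta)=\Pr(u_i>u_j\mid\theta)$. Let $\mathcal G=\{g_{kl}\ge 0:1\le k<l\le m\}$ be a weighted breaking (weights on pairs of positions), not all of whose weights are zero, and let $\mathcal W=\{w_{ij}\ge 0:i\ne j\}$ be weights on ordered pairs of distinct alternatives. For a profile $P=(R_1,\dots,R_n)$ of rankings let $\kappa_{ij}=\frac1n\sum_{t=1}^n \mathcal G_{a_i\succ a_j}(R_t)$, where $\mathcal G_{a_i\succ a_j}(R)=g_{kl}$ if $a_i$ and $a_j$ are in positions $k<l$ of $R$, and $\mathcal G_{a_i\succ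 a_j}(R)=0$ if $a_j$ is ranked above $a_i$. Let $\mathrm{RBCML}(\mathcal G,\mathcal W)(P)$ be the set of maximizers over $\theta\in\Theta$ of $\sum_{i\ne j}\kappa_{ij}w_{ij}\ln p_{ij}(\theta)$. Call $\mathrm{RBCML}(\mathcal G,\mathcal W)$ consistent for $\mathrm{RUM}(\pi)$ if for every $\theta_0\in\Theta$ and every $\varepsilon>0$, when $P$ consists of $n$ independent rankings drawn from $\mathrm{RUM}(\pi)$ with parameter $\theta_0$, the probability that a maximizer exists and that every maximizer is at distance less than $\varepsilon$ from $\theta_0$ tends to $1$ as $n\to\infty$. Then $\mathrm{RBCML}(\mathcal G,\mathcal W)$ is consistent for $\mathrm{RUM}(\pi)$ if and only if $\mathcal G$ is uniform (all $g_{kl}$ are equal), $\mathcal W$ is connected (the undirected graph on the alternatives with an edge $\{a_i,a_j\}$ whenever $w_{ij}>0$ or $w_{ji}>0$ is connected) and $\mathcal W$ is symmetric ($w_{ij}=w_{ji}$ for all $i\ne j$). -/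

import Mathlib

open MeasureTheory Filter Topology
open scoped NNReal BigOperators

namespace RBCML

noncomputable section

/-- A ranking of the alternatives `Fin m`: `R k` is the alternative in position `k`
(position `0` is the top), so that `R.symm i` is the position of alternative `i`. -/
abbrev Ranking (m : ℕ) := Equiv.Perm (Fin m)

/-- A preference profile of `n` rankings. -/
abbrev Profile (m n : ℕ) := Fin n → Ranking m

/-- The probability density of the shape of a utility distribution:
continuous, positive everywhere, of total mass one, and with mean zero. -/
structure IsUtilityDensity (π : ℝ → ℝ) : Prop where
  continuous : Continuous π
  pos : ∀ x, 0 < π x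
  integrable : Integrable π
  integral_eq_one : ∫ x, π x = 1
  integrable_mean : Integrable fun x => x * π x
  mean_eq_zero : ∫ x, x * π x = 0

/-- The parameter space of the location family: one location per alternative, the location
of the last alternative being normalised to zero. -/
def parameterSpace (m : ℕ) : Set (Fin m → ℝ) :=
  {θ | ∀ i : Fin m, i.val + 1 = m → θ i = 0}

/-- The joint law of the independent latent utilities: that of alternative `i` has
density `u ↦ π i (u - θ i)`. -/
def utilityLaw {m : ℕ} (π : Fin m → ℝ → ℝ) (θ : Fin m → ℝ) : Measure (Fin m → ℝ) :=
  Measure.pi fun i => volume.withDensity fun u => ENNReal.ofReal (π i (u - θ i))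

/-- The probability of generating the ranking `R`: the utilities decrease strictly along `R`. -/
def rankingProb {m : ℕ} (π : Fin m → ℝ → ℝ) (θ : Fin m → ℝ) (R : Ranking m) : ℝ :=
  (utilityLaw π θ).real {u | StrictAnti fun k => u (R k)}

/-- The marginal probability that alternative `i` is preferred to alternative `j`. -/
def pairProb {m : ℕ} (π : Fin m → ℝ → ℝ) (θ : Fin m → ℝ) (i j : Fin m) : ℝ :=
  (utilityLaw π θ).real {u | u j < u i}

/-- The probability that a profile of `n` independent rankings lies in `E`. -/
def profileProb {m : ℕ} (π : Fin m → ℝ → ℝ) (θ : Fin m → ℝ) {n : ℕ}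
    (E : Set (Profile m n)) : ℝ :=
  ∑ P : Profile m n, E.indicator (fun P => ∏ t, rankingProb π θ (P t)) P

/-- A weighted rank-breaking: nonnegative weights `g k l` on the pairs of positions `k < l`.
Entries with `l ≤ k` are never read. -/
structure Breaking (m : ℕ) where
  g : Fin m → Fin m → ℝ≥0

/-- The breaking has at least one edge. -/
def Breaking.HasEdge {m : ℕ} (G : Breaking m) : Prop :=
  ∃ k l, k < l ∧ 0 < G.g k l

/-- All weights of the breaking are the same. -/
def Breaking.Uniform {m : ℕ} (G : Breaking m) : Prop :=
  ∀ k l k' l', k < l → k' < l' → G.g k l = G.g k' l'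

/-- The weight of the comparisons "`i` is preferred to `j`" that `G` extracts from `R`. -/
def Breaking.comparisons {m : ℕ} (G : Breaking m) (R : Ranking m) (i j : Fin m) : ℝ :=
  if R.symm i < R.symm j then (G.g (R.symm i) (R.symm j) : ℝ) else 0

/-- The average `κ i j` of these weights over a profile. -/
def kappa {m n : ℕ} (G : Breaking m) (P : Profile m n) (i j : Fin m) : ℝ :=
  (∑ t, G.comparisons (P t) i j) / n

/-- A vector of nonnegative weights `w i j` for the ordered pairs of distinct alternatives.
Entries with `i = j` are never read. -/
structure CMLWeights (m : ℕ) where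
  w : Fin m → Fin m → ℝ≥0

def CMLWeights.Symmetric {m : ℕ} (W : CMLWeights m) : Prop :=
  ∀ i j, i ≠ j → W.w i j = W.w j i

/-- The undirected graph obtained by forgetting the directions of the positive-weight edges
is connected. -/
def CMLWeights.Connected {m : ℕ} (W : CMLWeights m) : Prop :=
  (SimpleGraph.fromRel fun i j => 0 < W.w i j).Connected

/-- The composite log-marginal likelihood. -/
def compositeLogLik {m n : ℕ} (π : Fin m → ℝ → ℝ) (G : Breaking m) (W : CMLWeights m)
    (P : Profile m n) (θ : Fin m → ℝ) : ℝ :=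
  ∑ i, ∑ j, if i ≠ j then
    kappa G P i j * (W.w i j : ℝ) * Real.log (pairProb π θ i j) else 0

/-- The output of RBCML: the set of maximisers of the composite log-marginal likelihood
over the parameter space. -/
def rbcml {m n : ℕ} (π : Fin m → ℝ → ℝ) (G : Breaking m) (W : CMLWeights m)
    (P : Profile m n) : Set (Fin m → ℝ) :=
  {θ | θ ∈ parameterSpace m ∧ IsMaxOn (compositeLogLik π G W P) (parameterSpace m) θ}

/-- Consistency for the location family with shapes `π`: for every ground truth `θ₀` the
output converges to `θ₀` in probability as the number of rankings grows. As the output is a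
set, this says that with probability tending to one a maximiser exists and all maximisers
are within `ε` of `θ₀`. -/
def IsConsistent {m : ℕ} (π : Fin m → ℝ → ℝ) (G : Breaking m) (W : CMLWeights m) : Prop :=
  ∀ θ₀ ∈ parameterSpace m, ∀ ε > 0,
    Tendsto (fun n : ℕ => profileProb π θ₀
        {P : Profile m n | (rbcml π G W P).Nonempty ∧ ∀ θ ∈ rbcml π G W P, dist θ θ₀ < ε})
      atTop (𝓝 1)

end

end RBCML

namespace RBCML

noncomputable section

variable {m : ℕ} {π : ℝ → ℝ}

/-! Utilities are locations plus i.i.d. noises, so `pairProb` is F(θ_i - θ_j) with F = `diffCDF`,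
where F has a positive even density f = `diffPDF` and F(t) + F(-t) = 1.

Sufficiency. A uniform breaking has expected comparison weights proportional to F(θ_i - θ_j). A
quantitative Pinsker bound shows that moving F at an edge away from its true value costs a square.
The linear terms cancel between (i,j) and (j,i) by symmetry of the weights. The law of large numbers
makes the sampling error negligible, and connectedness turns control on edges into control of the
parameter, anchored at the last alternative (`exists_dist_lt_of_likelihood_le`).

Necessity. If the weight graph is disconnected, a component can be shifted without changing the
likelihood. In general, consistency forces each ground truth to maximise its own expected
log-likelihood, so the gradient vanishes at every θ (`Stationary`). This is tested on configurations
`spread` with T → ∞. Since the score is unbounded, f(T + 1) = o(f(T)), so only the nearest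
alternative j survives in the equation of k (`IsSpread.tendsto_stationary`). Two conditional
expectations remain. Given the typical order j over k, the position of k is fixed, while that of j
depends on how many of the nearby alternatives A finish above it. Given the rare order k over j, the
two meet in the gap between their locations and are adjacent (`IsSpread.tendsto_ratio_rare`). With s
= |A| + |D| this gives w_kj g(s,s+1) = w_jk E g(|D| + N, s+1), where N = `nearCount`. Empty A gives
symmetry wherever g(s,s+1) is nonzero. Induction on |A| makes g independent of the upper position,
and reversing all rankings makes it independent of the lower one. -/

/-- The law of the noise added to the location of an alternative. -/
def noise (π : ℝ → ℝ) : Measure ℝ := volume.withDensity fun x => ENNReal.ofReal (π x)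

/-- The joint law of independent noises, one for each alternative. -/
def noiseLaw (m : ℕ) (π : ℝ → ℝ) : Measure (Fin m → ℝ) := Measure.pi fun _ => noise π

/-- The probability that the difference of two independent noises is below `t`. -/
def diffCDF (π : ℝ → ℝ) (t : ℝ) : ℝ := ((noise π).prod (noise π)).real {z | z.2 < z.1 + t}

/-- The density of the difference of two independent noises. -/
def diffPDF (π : ℝ → ℝ) (t : ℝ) : ℝ := ∫ x, π x * π (x + t)


/-! ### Independent noises and the law of their differences. -/

lemma measurable_ofReal_density (hπ : IsUtilityDensity π) :
    Measurable fun x => ENNReal.ofReal (π x) :=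
  hπ.continuous.measurable.ennreal_ofReal

lemma isProbabilityMeasure_noise (hπ : IsUtilityDensity π) : IsProbabilityMeasure (noise π) := by
  refine ⟨?_⟩
  rw [noise, withDensity_apply _ MeasurableSet.univ, Measure.restrict_univ,
    ← ofReal_integral_eq_lintegral_ofReal hπ.integrable (ae_of_all _ fun x => (hπ.pos x).le),
    hπ.integral_eq_one, ENNReal.ofReal_one]

instance : NullSingletonClass (noise π) := nullSingletonClass_withDensity _

instance [IsProbabilityMeasure (noise π)] : IsProbabilityMeasure (noiseLaw m π) := by
  unfold noiseLaw; infer_instance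

lemma noise_map_const_add (hπ : IsUtilityDensity π) (a : ℝ) :
    (noise π).map (fun x => a + x) =
      volume.withDensity fun u => ENNReal.ofReal (π (u - a)) := by
  ext s hs
  have h := (measurePreserving_add_left (volume : Measure ℝ) a).setLIntegral_comp_preimage hs
    (f := fun u => ENNReal.ofReal (π (u - a)))
    ((hπ.continuous.comp (by fun_prop : Continuous fun u : ℝ => u - a)).measurable.ennreal_ofReal)
  rw [Measure.map_apply (by fun_prop) hs, noise,
    withDensity_apply _ (hs.preimage (by fun_prop)), withDensity_apply _ hs, ← h]
  simp

lemma noise_map_neg (hπ : IsUtilityDensity π) (hsymm : ∀ x, π (-x) = π x) :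
    (noise π).map (fun x => -x) = noise π := by
  ext s hs
  have h := (Measure.measurePreserving_neg (volume : Measure ℝ)).setLIntegral_comp_preimage hs
    (measurable_ofReal_density hπ)
  rw [Measure.map_apply (by fun_prop) hs, noise,
    withDensity_apply _ (hs.preimage (by fun_prop)), withDensity_apply _ hs, ← h]
  simp only [hsymm]

lemma utilityLaw_eq_map (hπ : IsUtilityDensity π) (θ : Fin m → ℝ) :
    utilityLaw (fun _ => π) θ = (noiseLaw m π).map fun x => θ + x := by
  have := isProbabilityMeasure_noise hπ
  have : ∀ i : Fin m, IsProbabilityMeasure ((noise π).map fun x => θ i + x) := fun i =>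
    Measure.isProbabilityMeasure_map (by fun_prop)
  have h := Measure.pi_map_pi (μ := fun _ : Fin m => noise π) (f := fun i x => θ i + x)
    (fun i => by fun_prop)
  simp only [utilityLaw, ← noise_map_const_add hπ]
  exact h.symm

lemma noiseLaw_map_neg (hπ : IsUtilityDensity π) (hsymm : ∀ x, π (-x) = π x) :
    (noiseLaw m π).map (fun x => -x) = noiseLaw m π := by
  have := isProbabilityMeasure_noise hπ
  have : ∀ _ : Fin m, SigmaFinite ((noise π).map fun x => -x) := fun i => by
    rw [noise_map_neg hπ hsymm]; infer_instance
  have h := Measure.pi_map_pi (μ := fun _ : Fin m => noise π) (f := fun _ x => -x)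
    (fun i => by fun_prop)
  simp only [noise_map_neg hπ hsymm] at h
  exact h

lemma noiseLaw_map_pair [IsProbabilityMeasure (noise π)] {i j : Fin m} (hij : i ≠ j) :
    (noiseLaw m π).map (fun x => (x i, x j)) = (noise π).prod (noise π) := by
  have h := ProbabilityTheory.iIndepFun_pi (μ := fun _ : Fin m => noise π)
    (X := fun _ x => x) (fun i => by fun_prop)
  have h2 := (ProbabilityTheory.indepFun_iff_map_prod_eq_prod_map_map 
    (measurable_pi_apply i).aemeasurable (measurable_pi_apply j).aemeasurable).1 (h.indepFun hij)
  have he : ∀ i : Fin m, (Measure.pi fun _ : Fin m => noise π).map (fun x => x i) = noise π :=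
    fun i => (measurePreserving_eval (fun _ : Fin m => noise π) i).map_eq
  rw [he, he] at h2
  exact h2

lemma noiseLaw_map_eval [IsProbabilityMeasure (noise π)] (i : Fin m) :
    (noiseLaw m π).map (fun x => x i) = noise π :=
  (measurePreserving_eval (fun _ : Fin m => noise π) i).map_eq

lemma noiseLaw_pair [IsProbabilityMeasure (noise π)] {i j : Fin m} (hij : i ≠ j)
    {s : Set (ℝ × ℝ)} (hs : MeasurableSet s) :
    (noiseLaw m π).real {x | (x i, x j) ∈ s} = ((noise π).prod (noise π)).real s := by
  rw [← noiseLaw_map_pair hij, map_measureReal_apply (by fun_prop) hs]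
  rfl

lemma measurableSet_diff_lt (t : ℝ) : MeasurableSet {z : ℝ × ℝ | z.2 < z.1 + t} :=
  measurableSet_lt (by fun_prop) (by fun_prop)

lemma noiseLaw_lt [IsProbabilityMeasure (noise π)] (θ : Fin m → ℝ) {i j : Fin m} (hij : i ≠ j) :
    (noiseLaw m π).real {x | θ j + x j < θ i + x i} = diffCDF π (θ i - θ j) := by
  rw [diffCDF, ← noiseLaw_pair hij (measurableSet_diff_lt _)]
  congr 1
  ext x
  simp only [Set.mem_ofPred_eq]
  constructor <;> intro h <;> linarith

lemma pairProb_eq_diffCDF (hπ : IsUtilityDensity π) (θ : Fin m → ℝ) {i j : Fin m} (hij : i ≠ j) :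
    pairProb (fun _ => π) θ i j = diffCDF π (θ i - θ j) := by
  have := isProbabilityMeasure_noise hπ
  rw [← noiseLaw_lt θ hij, pairProb, utilityLaw_eq_map hπ, map_measureReal_apply (by fun_prop)
    (measurableSet_lt (by fun_prop) (by fun_prop))]
  rfl

lemma integral_noise (hπ : IsUtilityDensity π) (g : ℝ → ℝ) :
    ∫ x, g x ∂(noise π) = ∫ x, π x * g x := by
  rw [noise, integral_withDensity_eq_integral_toReal_smul (measurable_ofReal_density hπ)
    (ae_of_all _ fun _ => ENNReal.ofReal_lt_top)]
  simp [ENNReal.toReal_ofReal (hπ.pos _).le]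

lemma noise_real (hπ : IsUtilityDensity π) {s : Set ℝ} (hs : MeasurableSet s) :
    (noise π).real s = ∫ x in s, π x := by
  rw [measureReal_def, noise, withDensity_apply _ hs,
    ← ofReal_integral_eq_lintegral_ofReal hπ.integrable.integrableOn
      (ae_of_all _ fun x => (hπ.pos x).le),
    ENNReal.toReal_ofReal (setIntegral_nonneg hs fun x _ => (hπ.pos x).le)]

lemma hasDerivAt_noise_Iio (hπ : IsUtilityDensity π) (y : ℝ) :
    HasDerivAt (fun y => (noise π).real (Set.Iio y)) (π y) y := by
  have h1 : HasDerivAt (fun u => (∫ x in (0 : ℝ)..u, π x) + ∫ x in Set.Iic 0, π x) (π y) y :=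
    (intervalIntegral.integral_hasDerivAt_right hπ.integrable.intervalIntegrable
      hπ.continuous.stronglyMeasurable.stronglyMeasurableAtFilter
      hπ.continuous.continuousAt).add_const _
  refine h1.congr_of_eventuallyEq (Eventually.of_forall fun u => ?_)
  simp only
  rw [measureReal_congr (Iio_ae_eq_Iic (μ := noise π)), noise_real hπ measurableSet_Iic,
    ← intervalIntegral.integral_Iic_sub_Iic hπ.integrable.integrableOn
      hπ.integrable.integrableOn]
  ring

lemma diffCDF_eq_integral [IsProbabilityMeasure (noise π)] (t : ℝ) :
    diffCDF π t = ∫ x, (noise π).real (Set.Iio (x + t)) ∂(noise π) := by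
  have hm := measurableSet_diff_lt t
  rw [diffCDF, measureReal_def, Measure.prod_apply hm]
  exact (integral_toReal (measurable_measure_prodMk_left hm).aemeasurable
    (ae_of_all _ fun x => measure_lt_top _ _)).symm

lemma integrable_density_mul (hπ : IsUtilityDensity π) {B : ℝ} (hB : ∀ x, π x ≤ B) {g : ℝ → ℝ}
    (hg : Continuous g) : Integrable fun x => π x * π (g x) := by
  refine (hπ.integrable.mul_const B).mono'
    (hπ.continuous.mul (hπ.continuous.comp hg)).aestronglyMeasurable (ae_of_all _ fun x => ?_)
  rw [Real.norm_of_nonneg (mul_pos (hπ.pos _) (hπ.pos _)).le]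
  exact mul_le_mul_of_nonneg_left (hB _) (hπ.pos _).le

/-- Conditioning on one noise makes F an average of translates of the noise distribution function;
the bound on the density allows differentiation under the integral. -/
lemma hasDerivAt_diffCDF (hπ : IsUtilityDensity π) {B : ℝ} (hB : ∀ x, π x ≤ B) (t : ℝ) :
    HasDerivAt (diffCDF π) (diffPDF π t) t := by
  have := isProbabilityMeasure_noise hπ
  have hΦ : Continuous fun y => (noise π).real (Set.Iio y) :=
    continuous_iff_continuousAt.2 fun y => (hasDerivAt_noise_Iio hπ y).continuousAt
  have h := (hasDerivAt_integral_of_dominated_loc_of_deriv_le (μ := noise π) (s := Set.univ)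
    (x₀ := t) (F := fun t x => (noise π).real (Set.Iio (x + t))) (F' := fun t x => π (x + t))
    (bound := fun _ => B) univ_mem
    (Eventually.of_forall fun s => (hΦ.comp (by fun_prop : Continuous fun x : ℝ => x + s)).aestronglyMeasurable)
    (Integrable.of_bound (hΦ.comp (by fun_prop : Continuous fun x : ℝ => x + t)).aestronglyMeasurable 1
      (ae_of_all _ fun x => by
        rw [Real.norm_of_nonneg measureReal_nonneg]; exact measureReal_le_one))
    (hπ.continuous.comp (by fun_prop : Continuous fun x : ℝ => x + t)).aestronglyMeasurable
    (ae_of_all _ fun x s _ => by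
      rw [Real.norm_of_nonneg (hπ.pos _).le]; exact hB _)
    (integrable_const _)
    (ae_of_all _ fun x s _ => by
      simpa using (hasDerivAt_noise_Iio hπ (x + s)).comp_const_add x s)).2
  rw [integral_noise hπ] at h
  exact h.congr_of_eventuallyEq (Eventually.of_forall fun s => diffCDF_eq_integral s)

lemma diffPDF_pos (hπ : IsUtilityDensity π) {B : ℝ} (hB : ∀ x, π x ≤ B) (t : ℝ) :
    0 < diffPDF π t := by
  rw [diffPDF, integral_pos_iff_support_of_nonneg
    (fun x => (mul_pos (hπ.pos _) (hπ.pos _)).le) (integrable_density_mul hπ hB (by fun_prop))]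
  have : (Function.support fun x => π x * π (x + t)) = Set.univ :=
    Set.eq_univ_of_forall fun x => (mul_pos (hπ.pos _) (hπ.pos _)).ne'
  simp [this]

lemma diffPDF_neg (t : ℝ) : diffPDF π (-t) = diffPDF π t := by
  rw [diffPDF, diffPDF, ← integral_add_right_eq_self (fun x => π x * π (x + -t)) t]
  refine integral_congr_ae (ae_of_all _ fun x => ?_)
  simp [mul_comm]

lemma diffPDF_eq_conv (hsymm : ∀ x, π (-x) = π x) (t : ℝ) :
    diffPDF π t = ∫ x, π x * π (t - x) := by
  rw [diffPDF, ← integral_neg_eq_self]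
  refine integral_congr_ae (ae_of_all _ fun x => ?_)
  simp only [hsymm, neg_add_eq_sub]

lemma diffCDF_strictMono (hπ : IsUtilityDensity π) {B : ℝ} (hB : ∀ x, π x ≤ B) :
    StrictMono (diffCDF π) :=
  strictMono_of_deriv_pos fun t => by
    rw [(hasDerivAt_diffCDF hπ hB t).deriv]; exact diffPDF_pos hπ hB t

lemma continuous_diffCDF (hπ : IsUtilityDensity π) {B : ℝ} (hB : ∀ x, π x ≤ B) :
    Continuous (diffCDF π) :=
  continuous_iff_continuousAt.2 fun t => (hasDerivAt_diffCDF hπ hB t).continuousAt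

lemma diffCDF_pos (hπ : IsUtilityDensity π) {B : ℝ} (hB : ∀ x, π x ≤ B) (t : ℝ) :
    0 < diffCDF π t :=
  lt_of_le_of_lt measureReal_nonneg (diffCDF_strictMono hπ hB (sub_one_lt t))

lemma diffCDF_le_one [IsProbabilityMeasure (noise π)] (t : ℝ) : diffCDF π t ≤ 1 :=
  measureReal_le_one

lemma prod_noise_diff_eq_null [IsProbabilityMeasure (noise π)] (t : ℝ) :
    ((noise π).prod (noise π)) {z | z.2 = z.1 + t} = 0 := by
  rw [Measure.measure_prod_null (measurableSet_eq_fun (by fun_prop) (by fun_prop))]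
  refine ae_of_all _ fun x => ?_
  have : Prod.mk x ⁻¹' {z : ℝ × ℝ | z.2 = z.1 + t} = {x + t} := by ext y; simp
  simp [this]

/-- Exchanging the two noises complements the event up to ties, which are null. -/
lemma diffCDF_add_neg [IsProbabilityMeasure (noise π)] (t : ℝ) :
    diffCDF π t + diffCDF π (-t) = 1 := by
  have h1 : diffCDF π (-t) = ((noise π).prod (noise π)).real {z | z.2 < z.1 + t}ᶜ := by
    rw [diffCDF, ← Measure.prod_swap, map_measureReal_apply measurable_swap
      (measurableSet_diff_lt _), Measure.prod_swap]
    refine measureReal_congr ?_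
    have h0 : ∀ᵐ z ∂((noise π).prod (noise π)), z.2 ≠ z.1 + t := by
      rw [ae_iff]; simpa using prod_noise_diff_eq_null t
    filter_upwards [h0] with z hz
    apply propext
    change z.1 < z.2 + -t ↔ ¬ z.2 < z.1 + t
    constructor
    · intro h; linarith
    · intro h
      have := lt_of_le_of_ne (not_lt.1 h) (Ne.symm hz)
      linarith
  rw [h1, probReal_compl_eq_one_sub (measurableSet_diff_lt _), diffCDF]
  ring

lemma tendsto_diffCDF_atTop [IsProbabilityMeasure (noise π)] :
    Tendsto (diffCDF π) atTop (𝓝 1) := by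
  have h := tendsto_measure_iUnion_atTop (μ := (noise π).prod (noise π))
    (s := fun t : ℝ => {z : ℝ × ℝ | z.2 < z.1 + t}) (fun s t hst z (hz : z.2 < z.1 + s) =>
      show z.2 < z.1 + t by linarith)
  have hu : (⋃ t : ℝ, {z : ℝ × ℝ | z.2 < z.1 + t}) = Set.univ :=
    Set.eq_univ_of_forall fun z => Set.mem_iUnion.2 ⟨z.2 - z.1 + 1, by
      change z.2 < z.1 + (z.2 - z.1 + 1); linarith⟩
  rw [hu, measure_univ] at h
  exact (ENNReal.tendsto_toReal ENNReal.one_ne_top).comp h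

/-! ### Tail decay from the unbounded score. -/

lemma differentiable_log_density (hπ : IsUtilityDensity π) (hdiff : Differentiable ℝ π) :
    Differentiable ℝ fun x => Real.log (π x) :=
  fun x => (hdiff x).log (hπ.pos x).ne'

lemma deriv_log_density_neg (hsymm : ∀ x, π (-x) = π x) (x : ℝ) :
    deriv (fun x => Real.log (π x)) (-x) = -deriv (fun x => Real.log (π x)) x := by
  have h := deriv_comp_neg (fun x => Real.log (π x)) x
  simp only [hsymm] at h
  linarith

/-- The score is odd and decreasing, hence zero at the origin and nonpositive to the right of it.
Monotonicity of the score enters the proof only through this bound. -/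
lemma density_le_zero (hπ : IsUtilityDensity π) (hsymm : ∀ x, π (-x) = π x)
    (hdiff : Differentiable ℝ π) (hanti : Antitone (deriv fun x => Real.log (π x))) (x : ℝ) :
    π x ≤ π 0 := by
  have h0 : deriv (fun x => Real.log (π x)) 0 = 0 := by
    have := deriv_log_density_neg hsymm 0
    rw [neg_zero] at this; linarith
  have ha : AntitoneOn (fun x => Real.log (π x)) (Set.Ici 0) :=
    antitoneOn_of_deriv_nonpos (convex_Ici 0)
      (differentiable_log_density hπ hdiff).continuous.continuousOn
      (differentiable_log_density hπ hdiff).differentiableOn fun y hy => by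
        rw [interior_Ici] at hy
        exact h0 ▸ hanti (le_of_lt hy)
  have h1 : π |x| ≤ π 0 := (Real.log_le_log_iff (hπ.pos _) (hπ.pos _)).1
    (ha (Set.mem_Ici.2 le_rfl) (Set.mem_Ici.2 (abs_nonneg x)) (abs_nonneg x))
  rcases abs_choice x with h | h <;> rw [h] at h1
  · exact h1
  · rwa [hsymm] at h1

/-- By oddness the score tends to -∞ on the right, and the mean value theorem bounds the drop of the
log-density over a unit step by log ε. -/
lemma exists_density_add_one_le (hπ : IsUtilityDensity π) (hsymm : ∀ x, π (-x) = π x)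
    (hdiff : Differentiable ℝ π) (hlim : Tendsto (deriv fun x => Real.log (π x)) atBot atTop)
    {ε : ℝ} (hε : 0 < ε) : ∃ T : ℝ, ∀ x ≥ T, π (x + 1) ≤ ε * π x := by
  obtain ⟨a, ha⟩ := eventually_atBot.1 (hlim.eventually_ge_atTop (-Real.log ε))
  refine ⟨-a, fun x hx => ?_⟩
  have hd := differentiable_log_density hπ hdiff
  obtain ⟨c, hc, h⟩ := exists_deriv_eq_slope (fun x => Real.log (π x)) (lt_add_one x)
    hd.continuous.continuousOn hd.differentiableOn
  have h1 := ha (-c) (by linarith [hc.1])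
  rw [deriv_log_density_neg hsymm, h] at h1
  have h2 : Real.log (π (x + 1)) ≤ Real.log (ε * π x) := by
    rw [Real.log_mul hε.ne' (hπ.pos x).ne']
    simp at h1; linarith
  exact (Real.log_le_log_iff (hπ.pos _) (mul_pos hε (hπ.pos x))).1 h2

/-- In the convolution at t + 1 one of the two arguments is at least (t + 1)/2, hence in the tail.
Lowering that argument by one gains ε/2 and leaves an integrand of the convolution at t. -/
lemma exists_diffPDF_add_one_le (hπ : IsUtilityDensity π) (hsymm : ∀ x, π (-x) = π x)
    {B : ℝ} (hB : ∀ x, π x ≤ B)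
    (hdiff : Differentiable ℝ π) (hlim : Tendsto (deriv fun x => Real.log (π x)) atBot atTop)
    {ε : ℝ} (hε : 0 < ε) : ∃ T : ℝ, ∀ t ≥ T, diffPDF π (t + 1) ≤ ε * diffPDF π t := by
  obtain ⟨T, hT⟩ := exists_density_add_one_le hπ hsymm hdiff hlim (half_pos hε)
  refine ⟨2 * T + 1, fun t ht => ?_⟩
  have i1 : Integrable fun x => π x * π (t - x) := integrable_density_mul hπ hB (by fun_prop)
  have i2 : Integrable fun x => π (x - 1) * π (t + 1 - x) := by
    refine (i1.comp_sub_right 1).congr (ae_of_all _ fun x => ?_)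
    simp only; congr 2; ring
  have e2 : ∫ x, π (x - 1) * π (t + 1 - x) = diffPDF π t := by
    rw [diffPDF_eq_conv hsymm, ← integral_sub_right_eq_self (fun x => π x * π (t - x)) 1]
    refine integral_congr_ae (ae_of_all _ fun x => ?_)
    simp only; congr 2; ring
  have hle : diffPDF π (t + 1) ≤
      ∫ x, ε / 2 * (π x * π (t - x) + π (x - 1) * π (t + 1 - x)) := by
    rw [diffPDF_eq_conv hsymm]
    refine integral_mono (integrable_density_mul hπ hB (by fun_prop))
      ((i1.add i2).const_mul _) fun x => ?_
    have p1 := mul_pos (hπ.pos x) (hπ.pos (t - x))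
    have p2 := mul_pos (hπ.pos (x - 1)) (hπ.pos (t + 1 - x))
    rcases le_total x ((t + 1) / 2) with hx | hx
    · have h := hT (t - x) (by linarith)
      rw [show t - x + 1 = t + 1 - x by ring] at h
      have := mul_le_mul_of_nonneg_left h (hπ.pos x).le
      simp only; nlinarith [mul_pos hε p2]
    · have h := hT (x - 1) (by linarith)
      rw [sub_add_cancel] at h
      have := mul_le_mul_of_nonneg_right h (hπ.pos (t + 1 - x)).le
      simp only; nlinarith [mul_pos hε p1]
  rw [integral_const_mul, integral_add i1 i2, e2, ← diffPDF_eq_conv hsymm] at hle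
  linarith

/-- The first unit step gains the factor ε; the later ones only need not to increase f. -/
lemma exists_diffPDF_far_le (hπ : IsUtilityDensity π) (hsymm : ∀ x, π (-x) = π x)
    {B : ℝ} (hB : ∀ x, π x ≤ B)
    (hdiff : Differentiable ℝ π) (hlim : Tendsto (deriv fun x => Real.log (π x)) atBot atTop)
    {ε : ℝ} (hε : 0 < ε) :
    ∃ T : ℝ, ∀ t ≥ T, ∀ n : ℕ, diffPDF π (t + 1 + n) ≤ ε * diffPDF π t := by
  obtain ⟨T₁, h₁⟩ := exists_diffPDF_add_one_le hπ hsymm hB hdiff hlim hε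
  obtain ⟨T₂, h₂⟩ := exists_diffPDF_add_one_le hπ hsymm hB hdiff hlim one_pos
  refine ⟨max T₁ T₂, fun t ht n => ?_⟩
  induction n with
  | zero => simpa using h₁ t (le_trans (le_max_left _ _) ht)
  | succ n ih =>
    have h := h₂ (t + 1 + n) (by
      have := le_trans (le_max_right _ _) ht
      have : (0 : ℝ) ≤ n := n.cast_nonneg
      linarith)
    push_cast
    rw [← add_assoc]; linarith

lemma exists_noise_tail_le (hπ : IsUtilityDensity π) (hsymm : ∀ x, π (-x) = π x)
    (hdiff : Differentiable ℝ π) (hlim : Tendsto (deriv fun x => Real.log (π x)) atBot atTop)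
    {ε : ℝ} (hε : 0 < ε) :
    ∃ T : ℝ, ∀ t ≥ T, (noise π).real (Set.Ici (t + 1)) ≤ ε * (noise π).real (Set.Ici t) := by
  obtain ⟨T, hT⟩ := exists_density_add_one_le hπ hsymm hdiff hlim hε
  refine ⟨T, fun t ht => ?_⟩
  rw [noise_real hπ measurableSet_Ici, noise_real hπ measurableSet_Ici, ← integral_const_mul]
  have e := (measurePreserving_add_right (volume : Measure ℝ) 1).setIntegral_preimage_emb
    (measurableEmbedding_addRight 1) π (Set.Ici (t + 1))
  rw [← e, Set.preimage_add_const_Ici, add_sub_cancel_right]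
  exact setIntegral_mono_on (hπ.integrable.comp_add_right 1).integrableOn
    (hπ.integrable.const_mul ε).integrableOn measurableSet_Ici
    fun x hx => hT x (le_trans ht hx)

lemma noise_pos_of_isOpen (hπ : IsUtilityDensity π) {s : Set ℝ} (hs : IsOpen s)
    (hne : s.Nonempty) : 0 < noise π s := by
  rw [noise, withDensity_apply _ hs.measurableSet, setLIntegral_pos_iff
    (measurable_ofReal_density hπ)]
  have : (Function.support fun x => ENNReal.ofReal (π x)) = Set.univ :=
    Set.eq_univ_of_forall fun x => by simp [hπ.pos x]
  rw [this, Set.univ_inter]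
  exact hs.measure_pos _ hne

/-! ### Rankings induced by utilities and expected comparisons. -/

/-- The number of alternatives with a larger utility than `i`. -/
def cnt (u : Fin m → ℝ) (i : Fin m) : ℕ := (Finset.univ.filter fun l => u i < u l).card

/-- The weights of a breaking, indexed by natural numbers and extended by zero. -/
def Breaking.gNat (G : Breaking m) (a b : ℕ) : ℝ :=
  if h : a < m ∧ b < m then (G.g ⟨a, h.1⟩ ⟨b, h.2⟩ : ℝ) else 0

/-- The weight of the comparisons "`i` is preferred to `j`" in the ranking induced by `u`. -/
def Breaking.extract (G : Breaking m) (u : Fin m → ℝ) (i j : Fin m) : ℝ :=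
  if u j < u i then G.gNat (cnt u i) (cnt u j) else 0

/-- The expected weight of the comparisons "`i` is preferred to `j`". -/
def Breaking.mean (π : ℝ → ℝ) (G : Breaking m) (θ : Fin m → ℝ) (i j : Fin m) : ℝ :=
  ∫ x, G.extract (θ + x) i j ∂(noiseLaw m π)

lemma cnt_lt (u : Fin m → ℝ) (i : Fin m) : cnt u i < m := by
  have h : (Finset.univ.filter fun l => u i < u l) ⊂ Finset.univ :=
    Finset.filter_ssubset.2 ⟨i, Finset.mem_univ _, lt_irrefl _⟩
  simpa [cnt] using Finset.card_lt_card h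

lemma cnt_eq_of_strictAnti {u : Fin m → ℝ} {R : Ranking m} (h : StrictAnti fun k => u (R k))
    (i : Fin m) : cnt u i = (R.symm i : ℕ) := by
  have : (Finset.univ.filter fun l => u i < u l) =
      (Finset.Iio (R.symm i)).map R.toEmbedding := by
    ext l
    have := h.lt_iff_gt (a := R.symm i) (b := R.symm l)
    simp only [Equiv.apply_symm_apply] at this
    simp [← this]
  rw [cnt, this, Finset.card_map, Fin.card_Iio]

lemma ranking_unique {u : Fin m → ℝ} {R S : Ranking m} (hR : StrictAnti fun k => u (R k))
    (hS : StrictAnti fun k => u (S k)) : R = S := by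
  have h : R.symm = S.symm := by
    ext i
    rw [← cnt_eq_of_strictAnti hR, cnt_eq_of_strictAnti hS]
  simpa using congrArg Equiv.symm h

lemma exists_ranking {u : Fin m → ℝ} (hu : Function.Injective u) :
    ∃ R : Ranking m, StrictAnti fun k => u (R k) := by
  refine ⟨Tuple.sort fun i => -u i, ?_⟩
  have h1 := Tuple.monotone_sort fun i => -u i
  have h2 : StrictMono ((fun i => -u i) ∘ Tuple.sort fun i => -u i) :=
    h1.strictMono_of_injective ((neg_injective.comp hu).comp (Equiv.injective _))
  intro a b hab
  have := h2 hab
  simpa using this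

lemma extract_eq_comparisons (G : Breaking m) {u : Fin m → ℝ} {R : Ranking m}
    (h : StrictAnti fun k => u (R k)) (i j : Fin m) : G.extract u i j = G.comparisons R i j := by
  have h1 := h.lt_iff_gt (a := R.symm j) (b := R.symm i)
  simp only [Equiv.apply_symm_apply] at h1
  simp [Breaking.extract, Breaking.comparisons, h1, cnt_eq_of_strictAnti h, Breaking.gNat]

/-- Ties are null, so almost every utility vector induces a ranking and expectations can be computed
on utilities. -/
lemma ae_injective [IsProbabilityMeasure (noise π)] (θ : Fin m → ℝ) :
    ∀ᵐ x ∂(noiseLaw m π), Function.Injective (θ + x) := by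
  have h : ∀ i j : Fin m, i ≠ j → ∀ᵐ x ∂(noiseLaw m π), (θ + x) i ≠ (θ + x) j := by
    intro i j hij
    rw [ae_iff]
    have h0 := prod_noise_diff_eq_null (π := π) (θ i - θ j)
    rw [← noiseLaw_map_pair hij, Measure.map_apply (by fun_prop)
      (measurableSet_eq_fun (by fun_prop) (by fun_prop))] at h0
    convert h0 using 2
    ext x
    simp only [Pi.add_apply, ne_eq, not_not, Set.mem_ofPred_eq, Set.mem_preimage]
    constructor <;> intro h <;> linarith
  have h' := ae_all_iff.2 fun i => ae_all_iff.2 fun j => ae_all_iff.2 (h i j)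
  filter_upwards [h'] with x hx i j hij
  by_contra hne
  exact hx i j hne hij

lemma measurableSet_strictAnti (R : Ranking m) :
    MeasurableSet {u : Fin m → ℝ | StrictAnti fun k => u (R k)} := by
  have : {u : Fin m → ℝ | StrictAnti fun k => u (R k)} =
      ⋂ a, ⋂ b, ⋂ (_ : a < b), {u : Fin m → ℝ | u (R b) < u (R a)} := by
    ext u
    simp [StrictAnti]
  rw [this]
  exact MeasurableSet.iInter fun a => MeasurableSet.iInter fun b => MeasurableSet.iInter fun _ =>
    measurableSet_lt (by fun_prop) (by fun_prop)

lemma rankingProb_eq (hπ : IsUtilityDensity π) (θ : Fin m → ℝ) (R : Ranking m) :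
    rankingProb (fun _ => π) θ R =
      (noiseLaw m π).real {x | StrictAnti fun k => (θ + x) (R k)} := by
  rw [rankingProb, utilityLaw_eq_map hπ, map_measureReal_apply (by fun_prop)
    (measurableSet_strictAnti R)]
  rfl

lemma rankingProb_nonneg (θ : Fin m → ℝ) (R : Ranking m) :
    0 ≤ rankingProb (fun _ => π) θ R := measureReal_nonneg

/-- Expectations over rankings are expectations over utilities. -/
lemma sum_rankingProb_mul (hπ : IsUtilityDensity π) (θ : Fin m → ℝ) (h : Ranking m → ℝ)
    (g : (Fin m → ℝ) → ℝ)
    (hg : ∀ u R, StrictAnti (fun k => u (R k)) → g u = h R) :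
    ∑ R, rankingProb (fun _ => π) θ R * h R = ∫ x, g (θ + x) ∂(noiseLaw m π) := by
  have := isProbabilityMeasure_noise hπ
  have hm : ∀ R : Ranking m,
      MeasurableSet {x : Fin m → ℝ | StrictAnti fun k => (θ + x) (R k)} := fun R =>
    (measurableSet_strictAnti R).preimage (by fun_prop : Measurable fun x : Fin m → ℝ => θ + x)
  have h1 : ∀ R : Ranking m, rankingProb (fun _ => π) θ R * h R =
      ∫ x, {x | StrictAnti fun k => (θ + x) (R k)}.indicator (fun _ => h R) x
        ∂(noiseLaw m π) := by
    intro R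
    rw [integral_indicator_const _ (hm R), rankingProb_eq hπ, smul_eq_mul]
  simp_rw [h1]
  rw [← integral_finsetSum _ fun R _ => (integrable_const _).indicator (hm R)]
  refine integral_congr_ae ?_
  filter_upwards [ae_injective θ] with x hx
  obtain ⟨R, hR⟩ := exists_ranking hx
  rw [Finset.sum_eq_single R, Set.indicator_of_mem (by exact hR), hg _ R hR]
  · intro S _ hS
    exact Set.indicator_of_notMem (fun h => hS (ranking_unique h hR)) _
  · simp

lemma sum_rankingProb (hπ : IsUtilityDensity π) (θ : Fin m → ℝ) :
    ∑ R, rankingProb (fun _ => π) θ R = 1 := by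
  have := isProbabilityMeasure_noise hπ
  have h := sum_rankingProb_mul hπ θ (fun _ => 1) (fun _ => 1) fun _ _ _ => rfl
  simpa using h

lemma sum_rankingProb_comparisons (hπ : IsUtilityDensity π) (G : Breaking m) (θ : Fin m → ℝ)
    (i j : Fin m) :
    ∑ R, rankingProb (fun _ => π) θ R * G.comparisons R i j = G.mean π θ i j :=
  sum_rankingProb_mul hπ θ _ (fun u => G.extract u i j) fun _ _ h => extract_eq_comparisons G h i j

lemma measurable_cnt (i : Fin m) : Measurable fun u : Fin m → ℝ => cnt u i := by
  simp only [cnt, Finset.card_filter]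
  refine Finset.measurable_fun_sum _ fun l _ => ?_
  exact Measurable.ite (measurableSet_lt (by fun_prop) (by fun_prop)) measurable_const
    measurable_const

lemma measurable_extract (G : Breaking m) (i j : Fin m) :
    Measurable fun u : Fin m → ℝ => G.extract u i j := by
  refine Measurable.ite (measurableSet_lt (by fun_prop) (by fun_prop)) ?_ measurable_const
  have h : Measurable fun z : ℕ × ℕ => G.gNat z.1 z.2 := measurable_of_countable _
  exact h.comp ((measurable_cnt i).prodMk (measurable_cnt j))

lemma gNat_nonneg (G : Breaking m) (a b : ℕ) : 0 ≤ G.gNat a b := by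
  unfold Breaking.gNat; split_ifs <;> positivity

lemma exists_gNat_le (G : Breaking m) : ∃ C : ℝ, 0 ≤ C ∧ ∀ a b, G.gNat a b ≤ C := by
  refine ⟨∑ k, ∑ l, (G.g k l : ℝ), by positivity, fun a b => ?_⟩
  unfold Breaking.gNat
  split_ifs with h
  · have h1 : (G.g ⟨a, h.1⟩ ⟨b, h.2⟩ : ℝ) ≤ ∑ l, (G.g ⟨a, h.1⟩ l : ℝ) :=
      Finset.single_le_sum (f := fun l => (G.g ⟨a, h.1⟩ l : ℝ)) (fun _ _ => by positivity)
        (Finset.mem_univ _)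
    exact h1.trans (Finset.single_le_sum (f := fun k => ∑ l, (G.g k l : ℝ))
      (fun _ _ => by positivity) (Finset.mem_univ _))
  · positivity

lemma extract_nonneg (G : Breaking m) (u : Fin m → ℝ) (i j : Fin m) : 0 ≤ G.extract u i j := by
  unfold Breaking.extract; split_ifs
  · exact gNat_nonneg G _ _
  · exact le_rfl

lemma extract_le (G : Breaking m) {C : ℝ} (hC : 0 ≤ C ∧ ∀ a b, G.gNat a b ≤ C)
    (u : Fin m → ℝ) (i j : Fin m) : G.extract u i j ≤ C := by
  unfold Breaking.extract; split_ifs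
  · exact hC.2 _ _
  · exact hC.1

lemma integrable_extract [IsProbabilityMeasure (noise π)] (G : Breaking m) (θ : Fin m → ℝ)
    (i j : Fin m) : Integrable (fun x => G.extract (θ + x) i j) (noiseLaw m π) := by
  obtain ⟨C, hC⟩ := exists_gNat_le G
  refine Integrable.of_bound ((measurable_extract G i j).comp
    (by fun_prop : Measurable fun x : Fin m → ℝ => θ + x)).aestronglyMeasurable C
    (ae_of_all _ fun x => ?_)
  rw [Real.norm_of_nonneg (extract_nonneg _ _ _ _)]
  exact extract_le G hC _ _ _

lemma mean_nonneg (G : Breaking m) (θ : Fin m → ℝ) (i j : Fin m) : 0 ≤ G.mean π θ i j :=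
  integral_nonneg fun _ => extract_nonneg _ _ _ _

lemma measurableSet_noise_lt (θ : Fin m → ℝ) (i j : Fin m) :
    MeasurableSet {x : Fin m → ℝ | θ j + x j < θ i + x i} :=
  measurableSet_lt (by fun_prop) (by fun_prop)

lemma mean_le [IsProbabilityMeasure (noise π)] (G : Breaking m) {C : ℝ}
    (hC : 0 ≤ C ∧ ∀ a b, G.gNat a b ≤ C) (θ : Fin m → ℝ) {i j : Fin m} (hij : i ≠ j) :
    G.mean π θ i j ≤ C * diffCDF π (θ i - θ j) := by
  rw [← noiseLaw_lt θ hij, mul_comm, ← smul_eq_mul,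
    ← integral_indicator_const _ (measurableSet_noise_lt θ i j)]
  refine integral_mono (integrable_extract G θ i j)
    ((integrable_const C).indicator (measurableSet_noise_lt θ i j)) fun x => ?_
  by_cases h : θ j + x j < θ i + x i
  · simp only [Set.indicator_of_mem (show x ∈ {x | θ j + x j < θ i + x i} from h)]
    exact extract_le G hC _ _ _
  · simp only [Set.indicator_of_notMem (show x ∉ {x | θ j + x j < θ i + x i} from h)]
    exact (if_neg h).le

lemma mean_add_const (G : Breaking m) (θ : Fin m → ℝ) (c : ℝ) (i j : Fin m) :
    G.mean π (fun l => θ l + c) i j = G.mean π θ i j := by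
  refine integral_congr_ae (ae_of_all _ fun x => ?_)
  simp only [Breaking.extract, cnt, Pi.add_apply, add_right_comm _ c, add_lt_add_iff_right]

/-! ### The law of large numbers for finite product laws. -/

lemma sum_prod_eq_one {α : Type*} [Fintype α] {p : α → ℝ} (hp : ∑ a, p a = 1) (n : ℕ) :
    ∑ P : Fin n → α, ∏ t, p (P t) = 1 := by
  classical
  have h := Finset.prod_univ_sum (fun _ : Fin n => (Finset.univ : Finset α)) (fun _ a => p a)
  rw [Fintype.piFinset_univ] at h
  rw [← h]
  simp [hp]

/-- The second moment of a sum of independent centred variables. -/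
lemma sum_prod_mul_sq {α : Type*} [Fintype α] {p : α → ℝ} (hp : ∑ a, p a = 1) {Y : α → ℝ}
    (hY : ∑ a, p a * Y a = 0) (n : ℕ) :
    ∑ P : Fin n → α, (∏ t, p (P t)) * (∑ t, Y (P t)) ^ 2 = n * ∑ a, p a * Y a ^ 2 := by
  induction n with
  | zero => simp
  | succ n ih =>
    rw [← (Fin.consEquiv fun _ : Fin (n + 1) => α).sum_comp, Fintype.sum_prod_type]
    -- Splitting off the first draw, the cross term of the square vanishes because `Y` is centred.
    have h : ∀ (a : α) (P : Fin n → α),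
        (∏ t, p ((Fin.consEquiv fun _ : Fin (n + 1) => α) (a, P) t)) *
          (∑ t, Y ((Fin.consEquiv fun _ : Fin (n + 1) => α) (a, P) t)) ^ 2 =
        p a * Y a ^ 2 * (∏ t, p (P t)) + 2 * (p a * Y a) * ((∏ t, p (P t)) * ∑ t, Y (P t))
          + p a * ((∏ t, p (P t)) * (∑ t, Y (P t)) ^ 2) := by
      intro a P
      simp only [Fin.consEquiv_apply, Fin.prod_univ_succ, Fin.sum_univ_succ, Fin.cons_zero,
        Fin.cons_succ]
      ring
    simp_rw [h, Finset.sum_add_distrib, ← Finset.mul_sum, sum_prod_eq_one hp, ih,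
      ← Finset.sum_mul, ← Finset.mul_sum, hY, hp]
    push_cast
    ring

lemma profileProb_le_one (hπ : IsUtilityDensity π) (θ : Fin m → ℝ) {n : ℕ}
    (E : Set (Profile m n)) : profileProb (fun _ => π) θ E ≤ 1 := by
  rw [← sum_prod_eq_one (sum_rankingProb hπ θ) n]
  refine Finset.sum_le_sum fun P _ => Set.indicator_le_self' (fun _ _ => ?_) P
  exact Finset.prod_nonneg fun t _ => rankingProb_nonneg θ _

lemma profileProb_mono (θ : Fin m → ℝ) {n : ℕ} {E E' : Set (Profile m n)} (h : E ⊆ E') :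
    profileProb (fun _ => π) θ E ≤ profileProb (fun _ => π) θ E' :=
  Finset.sum_le_sum fun P _ => Set.indicator_le_indicator_of_subset h
    (fun _ => Finset.prod_nonneg fun _ _ => rankingProb_nonneg θ _) P

lemma profileProb_add_le (hπ : IsUtilityDensity π) (θ : Fin m → ℝ) {n : ℕ}
    {E E' : Set (Profile m n)} (h : Disjoint E E') :
    profileProb (fun _ => π) θ E + profileProb (fun _ => π) θ E' ≤ 1 := by
  refine le_trans (le_of_eq ?_) (profileProb_le_one hπ θ (E ∪ E'))
  rw [profileProb, profileProb, profileProb, ← Finset.sum_add_distrib]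
  refine Finset.sum_congr rfl fun P _ => ?_
  rw [Set.indicator_union_of_disjoint h]

lemma kappa_sub_mean (G : Breaking m) (θ : Fin m → ℝ) {n : ℕ}
    (hn : 0 < n) (P : Profile m n) (i j : Fin m) :
    (∑ t, (G.comparisons (P t) i j - G.mean π θ i j)) / n = kappa G P i j - G.mean π θ i j := by
  have : (n : ℝ) ≠ 0 := by positivity
  rw [Finset.sum_sub_distrib, kappa]
  simp
  field_simp

/-- The weak law of large numbers for the averages `kappa`. -/
lemma tendsto_profileProb_kappa (hπ : IsUtilityDensity π) (G : Breaking m) (θ : Fin m → ℝ)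
    {δ : ℝ} (hδ : 0 < δ) :
    Tendsto (fun n : ℕ => profileProb (fun _ => π) θ
      {P : Profile m n | ∀ i j, |kappa G P i j - G.mean π θ i j| < δ}) atTop (𝓝 1) := by
  set p := rankingProb (fun _ : Fin m => π) θ with hp_def
  have hp := sum_rankingProb hπ θ
  set Y : Fin m → Fin m → Ranking m → ℝ := fun i j R =>
    G.comparisons R i j - G.mean π θ i j with hY_def
  have hY : ∀ i j, ∑ R, p R * Y i j R = 0 := by
    intro i j
    simp only [hY_def, mul_sub, Finset.sum_sub_distrib, ← Finset.sum_mul, hp_def, hp,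
      sum_rankingProb_comparisons hπ, one_mul, sub_self]
  set V : ℝ := ∑ i, ∑ j, ∑ R, p R * Y i j R ^ 2 with hV
  have hbound : ∀ n : ℕ, 0 < n → 1 - V / δ ^ 2 * (1 / n) ≤ profileProb (fun _ => π) θ
      {P : Profile m n | ∀ i j, |kappa G P i j - G.mean π θ i j| < δ} := by
    intro n hn
    have hn' : (0 : ℝ) < n := by exact_mod_cast hn
    set E := {P : Profile m n | ∀ i j, |kappa G P i j - G.mean π θ i j| < δ} with hE
    -- Chebyshev and the union bound over pairs, in pointwise form: outside `E` one of the quadratic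
    -- terms alone exceeds the probability of the profile.
    have hpt : ∀ P : Profile m n, ∏ t, p (P t) -
        ∑ i, ∑ j, (∏ t, p (P t)) * (∑ t, Y i j (P t)) ^ 2 / (n ^ 2 * δ ^ 2) ≤
        E.indicator (fun P => ∏ t, p (P t)) P := by
      intro P
      have hw : 0 ≤ ∏ t, p (P t) := Finset.prod_nonneg fun t _ => rankingProb_nonneg θ _
      have hnn : ∀ i j, 0 ≤ (∏ t, p (P t)) * (∑ t, Y i j (P t)) ^ 2 / (n ^ 2 * δ ^ 2) :=
        fun i j => by positivity
      by_cases hP : P ∈ E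
      · rw [Set.indicator_of_mem hP]
        have := Finset.sum_nonneg fun i (_ : i ∈ Finset.univ) =>
          Finset.sum_nonneg fun j (_ : j ∈ Finset.univ) => hnn i j
        linarith
      · rw [Set.indicator_of_notMem hP, sub_nonpos]
        simp only [hE, Set.mem_ofPred_eq, not_forall, not_lt] at hP
        obtain ⟨i, j, hij⟩ := hP
        have h1 : ∏ t, p (P t) ≤
            (∏ t, p (P t)) * (∑ t, Y i j (P t)) ^ 2 / (n ^ 2 * δ ^ 2) := by
          rw [← kappa_sub_mean G θ hn, abs_div, le_div_iff₀ (by positivity),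
            abs_of_pos hn'] at hij
          have h2 : (δ * n) ^ 2 ≤ (∑ t, Y i j (P t)) ^ 2 := by
            rw [← sq_abs (∑ t, Y i j (P t))]
            exact pow_le_pow_left₀ (by positivity) hij 2
          rw [le_div_iff₀ (by positivity)]
          nlinarith [mul_le_mul_of_nonneg_left h2 hw]
        refine h1.trans ((Finset.single_le_sum (fun j _ => hnn i j) (Finset.mem_univ j)).trans ?_)
        exact Finset.single_le_sum (f := fun i => ∑ j, _)
          (fun i _ => Finset.sum_nonneg fun j _ => hnn i j) (Finset.mem_univ i)
    have hsum := Finset.sum_le_sum fun P (_ : P ∈ (Finset.univ : Finset (Profile m n))) => hpt P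
    refine le_trans (le_of_eq ?_) hsum
    rw [Finset.sum_sub_distrib, sum_prod_eq_one hp, Finset.sum_comm]
    congr 1
    have hin : ∀ i, ∑ P : Profile m n, ∑ j,
        (∏ t, p (P t)) * (∑ t, Y i j (P t)) ^ 2 / (n ^ 2 * δ ^ 2) =
        ∑ j, n * (∑ R, p R * Y i j R ^ 2) / (n ^ 2 * δ ^ 2) := by
      intro i
      rw [Finset.sum_comm]
      refine Finset.sum_congr rfl fun j _ => ?_
      rw [← Finset.sum_div, sum_prod_mul_sq hp (hY i j)]
    simp_rw [hin, ← Finset.sum_div, ← Finset.mul_sum]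
    rw [← hV]
    field_simp
  have hlim : Tendsto (fun n : ℕ => 1 - V / δ ^ 2 * (1 / (n : ℝ))) atTop (𝓝 1) := by
    simpa using (tendsto_one_div_atTop_nhds_zero_nat (𝕜 := ℝ)).const_mul (V / δ ^ 2) |>.const_sub 1
  refine tendsto_of_tendsto_of_tendsto_of_le_of_le' hlim tendsto_const_nhds ?_
    (Eventually.of_forall fun n => profileProb_le_one hπ θ _)
  filter_upwards [eventually_gt_atTop 0] with n hn using hbound n hn

/-! ### Sufficiency: uniform breakings with connected symmetric weights. -/

lemma kappa_nonneg (G : Breaking m) {n : ℕ} (P : Profile m n) (i j : Fin m) :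
    0 ≤ kappa G P i j := by
  refine div_nonneg (Finset.sum_nonneg fun t _ => ?_) n.cast_nonneg
  unfold Breaking.comparisons
  split_ifs <;> positivity

lemma log_le_two_mul_sqrt_sub_one {x : ℝ} (hx : 0 < x) : Real.log x ≤ 2 * (√x - 1) := by
  have h := Real.log_le_sub_one_of_pos (Real.sqrt_pos.2 hx)
  rw [Real.log_sqrt hx.le] at h
  linarith

/-- A form of Pinsker's inequality for perturbed frequencies. -/
lemma mul_log_sub_log_le {k g p F δ : ℝ} (hk : 0 ≤ k) (hg : 0 ≤ g) (hp : 0 < p) (hp1 : p ≤ 1)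
    (hF : 0 < F) (hF1 : F ≤ 1) (hδ : |k - g * p| ≤ δ) :
    k * (Real.log F - Real.log p) ≤ g * (F - p) - g * ((F - p) ^ 2 / 4) + 2 * δ / √p := by
  -- In terms of square roots, log x ≤ 2(√x - 1) produces a Hellinger term g(b - a)², which
  -- dominates the square of F - p because a + b ≤ 2.
  obtain ⟨a, ha, ha2⟩ : ∃ a, 0 < a ∧ a ^ 2 = p := ⟨√p, Real.sqrt_pos.2 hp, Real.sq_sqrt hp.le⟩
  obtain ⟨b, hb, hb2⟩ : ∃ b, 0 < b ∧ b ^ 2 = F := ⟨√F, Real.sqrt_pos.2 hF, Real.sq_sqrt hF.le⟩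
  subst ha2 hb2
  have ha1 : a ≤ 1 := by nlinarith
  have hb1 : b ≤ 1 := by nlinarith
  have h1 : Real.log (b ^ 2) - Real.log (a ^ 2) ≤ 2 * (b / a - 1) := by
    rw [← Real.log_div (by positivity) (by positivity), ← div_pow]
    have := log_le_two_mul_sqrt_sub_one (x := (b / a) ^ 2) (by positivity)
    rwa [Real.sqrt_sq (by positivity)] at this
  have h2 : k * (Real.log (b ^ 2) - Real.log (a ^ 2)) ≤ k * (2 * (b / a - 1)) :=
    mul_le_mul_of_nonneg_left h1 hk
  have h3 : |b / a - 1| ≤ 1 / a := by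
    have e : b / a - 1 = (b - a) / a := by field_simp
    rw [e, abs_div, abs_of_pos ha]
    gcongr
    rw [abs_le]; constructor <;> linarith
  have h4 : (k - g * a ^ 2) * (b / a - 1) ≤ δ * (1 / a) :=
    (le_abs_self _).trans (by
      rw [abs_mul]; exact mul_le_mul hδ h3 (abs_nonneg _) ((abs_nonneg _).trans hδ))
  have e5 : g * a ^ 2 * (2 * (b / a - 1)) = g * (b ^ 2 - a ^ 2) - g * (b - a) ^ 2 := by
    field_simp; ring
  have h6 : (b ^ 2 - a ^ 2) ^ 2 / 4 ≤ (b - a) ^ 2 := by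
    have : (b + a) ^ 2 ≤ 4 := by nlinarith
    nlinarith [mul_le_mul_of_nonneg_left this (sq_nonneg (b - a))]
  have h7 := mul_le_mul_of_nonneg_left h6 hg
  rw [Real.sqrt_sq ha.le]
  have e8 : k * (2 * (b / a - 1)) =
      2 * ((k - g * a ^ 2) * (b / a - 1)) + g * a ^ 2 * (2 * (b / a - 1)) := by ring
  have e9 : 2 * δ / a = 2 * (δ * (1 / a)) := by ring
  rw [e9]
  linarith

lemma sum_sum_eq_zero_of_antisymm {ι : Type*} [Fintype ι] {a : ι → ι → ℝ}
    (h : ∀ i j, a i j = -a j i) : ∑ i, ∑ j, a i j = 0 := by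
  have h1 : ∑ i, ∑ j, a i j = -∑ i, ∑ j, a i j := by
    conv_lhs => rw [Finset.sum_comm]
    rw [← Finset.sum_neg_distrib]
    refine Finset.sum_congr rfl fun i _ => ?_
    rw [← Finset.sum_neg_distrib]
    exact Finset.sum_congr rfl fun j _ => h j i
  linarith

lemma compositeLogLik_eq (hπ : IsUtilityDensity π) (G : Breaking m) (W : CMLWeights m) {n : ℕ}
    (P : Profile m n) (θ : Fin m → ℝ) :
    compositeLogLik (fun _ => π) G W P θ = ∑ i, ∑ j, if i ≠ j then
      kappa G P i j * (W.w i j : ℝ) * Real.log (diffCDF π (θ i - θ j)) else 0 := by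
  refine Finset.sum_congr rfl fun i _ => Finset.sum_congr rfl fun j _ => ?_
  split_ifs with h
  · rw [pairProb_eq_diffCDF hπ θ h]
  · rfl

lemma continuous_compositeLogLik (hπ : IsUtilityDensity π) {B : ℝ} (hB : ∀ x, π x ≤ B)
    (G : Breaking m) (W : CMLWeights m) {n : ℕ} (P : Profile m n) :
    Continuous (compositeLogLik (fun _ => π) G W P) := by
  simp_rw [funext (compositeLogLik_eq hπ G W P)]
  refine continuous_finsetSum _ fun i _ => continuous_finsetSum _ fun j _ => ?_
  split_ifs
  · exact continuous_const.mul (((continuous_diffCDF hπ hB).comp (by fun_prop)).log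
      fun θ => (diffCDF_pos hπ hB _).ne')
  · exact continuous_const

lemma cnt_lt_cnt {u : Fin m → ℝ} {i j : Fin m} (h : u j < u i) : cnt u i < cnt u j := by
  refine Finset.card_lt_card (Finset.ssubset_iff_of_subset ?_ |>.2 ⟨i, by simpa using h, by simp⟩)
  intro l
  simp only [Finset.mem_filter, Finset.mem_univ, true_and]
  exact h.trans

lemma mean_of_uniform [IsProbabilityMeasure (noise π)] (G : Breaking m) {g₀ : ℝ}
    (hG : ∀ k l, k < l → (G.g k l : ℝ) = g₀) (θ : Fin m → ℝ) {i j : Fin m} (hij : i ≠ j) :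
    G.mean π θ i j = g₀ * diffCDF π (θ i - θ j) := by
  rw [← noiseLaw_lt θ hij, mul_comm, ← smul_eq_mul,
    ← integral_indicator_const _ (measurableSet_noise_lt θ i j)]
  refine integral_congr_ae (ae_of_all _ fun x => ?_)
  simp only [Breaking.extract, Set.indicator_apply, Set.mem_ofPred_eq, Pi.add_apply]
  split_ifs with h
  · rw [Breaking.gNat, dif_pos ⟨cnt_lt _ _, cnt_lt _ _⟩]
    exact hG _ _ (cnt_lt_cnt h)
  · rfl

/-- Strict monotonicity makes this global in t, so no parameter can escape to infinity. -/
lemma diffCDF_inverse_modulus (hπ : IsUtilityDensity π) {B : ℝ} (hB : ∀ x, π x ≤ B) (d : ℝ)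
    {ε : ℝ} (hε : 0 < ε) :
    ∃ η > 0, ∀ t, |diffCDF π t - diffCDF π d| < η → |t - d| < ε := by
  have hs := diffCDF_strictMono hπ hB
  refine ⟨min (diffCDF π (d + ε) - diffCDF π d) (diffCDF π d - diffCDF π (d - ε)),
    lt_min (sub_pos.2 (hs (by linarith))) (sub_pos.2 (hs (by linarith))), fun t ht => ?_⟩
  have h1 := (abs_lt.1 (ht.trans_le (min_le_left _ _))).2
  have h2 := (abs_lt.1 (ht.trans_le (min_le_right _ _))).1
  have h3 : t < d + ε := hs.lt_iff_lt.1 (by linarith)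
  have h4 : d - ε < t := hs.lt_iff_lt.1 (by linarith)
  rw [abs_lt]; constructor <;> linarith

/-- Control of the differences along edges gives control along walks. -/
lemma abs_sub_le_of_walk {V : Type*} {H : SimpleGraph V} {x : V → ℝ} {ε : ℝ}
    (h : ∀ a b, H.Adj a b → |x a - x b| ≤ ε) {a b : V} (p : H.Walk a b) :
    |x a - x b| ≤ p.length * ε := by
  induction p with
  | nil => simp
  | @cons a b c hab p ih =>
    have h1 := abs_sub_le (x a) (x b) (x c)
    have h2 := h _ _ hab
    rw [SimpleGraph.Walk.length_cons]
    push_cast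
    linarith

/-- Parameters at least as good as the ground truth are close to it when the averages are close
to their expectations. -/
lemma exists_dist_lt_of_likelihood_le (hm : 0 < m) (hπ : IsUtilityDensity π) {B : ℝ}
    (hB : ∀ x, π x ≤ B) (G : Breaking m) {g₀ : ℝ} (hg₀ : 0 < g₀)
    (hG : ∀ k l, k < l → (G.g k l : ℝ) = g₀) (W : CMLWeights m) (hW : W.Connected)
    (hWs : W.Symmetric) {θ₀ : Fin m → ℝ} (hθ₀ : θ₀ ∈ parameterSpace m) {ε : ℝ} (hε : 0 < ε) :
    ∃ δ > 0, ∀ (n : ℕ) (P : Profile m n),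
      (∀ i j, |kappa G P i j - G.mean π θ₀ i j| < δ) → ∀ θ ∈ parameterSpace m,
      compositeLogLik (fun _ => π) G W P θ₀ ≤ compositeLogLik (fun _ => π) G W P θ →
      dist θ θ₀ < ε := by
  have := isProbabilityMeasure_noise hπ
  -- A path in the weight graph has fewer than m edges, so errors of `ε'` per edge add up to less
  -- than ε.
  set ε' : ℝ := ε / (m + 1) with hε'
  have hε'0 : 0 < ε' := by positivity
  choose η hη0 hη using fun d => diffCDF_inverse_modulus hπ hB d hε'0
  set F : (Fin m → ℝ) → Fin m → Fin m → ℝ := fun θ i j => diffCDF π (θ i - θ j) with hF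
  have hF0 : ∀ θ i j, 0 < F θ i j := fun θ i j => diffCDF_pos hπ hB _
  have hF1 : ∀ θ i j, F θ i j ≤ 1 := fun θ i j => diffCDF_le_one _
  -- The total error is at most `δ * C`; δ is chosen so that this is below the loss caused by a
  -- deviation on any single edge.
  set C : ℝ := ∑ i, ∑ j, (W.w i j : ℝ) * (2 / √(F θ₀ i j)) with hC
  obtain ⟨δ, hδ, hδ0⟩ : ∃ δ : ℝ, (∀ i j, 0 < W.w i j →
      δ * C < W.w i j * (g₀ * (η (θ₀ i - θ₀ j) ^ 2 / 4))) ∧ 0 < δ := by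
    have hev : ∀ᶠ δ in 𝓝[>] (0 : ℝ), ∀ i j, 0 < W.w i j →
        δ * C < W.w i j * (g₀ * (η (θ₀ i - θ₀ j) ^ 2 / 4)) := by
      refine eventually_all.2 fun i => eventually_all.2 fun j => eventually_imp_distrib_left.2
        fun hw => ?_
      have h0 : (0 : ℝ) * C < W.w i j * (g₀ * (η (θ₀ i - θ₀ j) ^ 2 / 4)) := by
        have := hη0 (θ₀ i - θ₀ j)
        rw [zero_mul]; positivity
      exact nhdsWithin_le_nhds ((continuous_mul_const C).continuousAt.eventually_lt
        continuousAt_const h0)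
    exact (hev.and self_mem_nhdsWithin).exists
  refine ⟨δ, hδ0, fun n P hP θ hθ hL => ?_⟩
  have hterm : ∀ i j, (if i ≠ j then kappa G P i j * (W.w i j : ℝ) * Real.log (F θ i j) else 0) -
      (if i ≠ j then kappa G P i j * (W.w i j : ℝ) * Real.log (F θ₀ i j) else 0) ≤
      (if i ≠ j then (W.w i j : ℝ) * (g₀ * (F θ i j - F θ₀ i j)) else 0) -
      (if i ≠ j then (W.w i j : ℝ) * (g₀ * ((F θ i j - F θ₀ i j) ^ 2 / 4)) else 0) +
      δ * ((W.w i j : ℝ) * (2 / √(F θ₀ i j))) := by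
    intro i j
    split_ifs with hij
    · have h := mul_log_sub_log_le (kappa_nonneg G P i j) hg₀.le (hF0 θ₀ i j) (hF1 θ₀ i j)
        (hF0 θ i j) (hF1 θ i j) (δ := δ) (by
          have := (hP i j).le
          rwa [mean_of_uniform G hG θ₀ hij] at this)
      have h' := mul_le_mul_of_nonneg_left h (W.w i j).coe_nonneg
      have e : (W.w i j : ℝ) * (2 * δ / √(F θ₀ i j)) =
        δ * ((W.w i j : ℝ) * (2 / √(F θ₀ i j))) := by ring
      linarith
    · have : 0 ≤ δ * ((W.w i j : ℝ) * (2 / √(F θ₀ i j))) := by positivity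
      linarith
  have hsum := Finset.sum_le_sum fun i (_ : i ∈ Finset.univ) =>
    Finset.sum_le_sum fun j (_ : j ∈ Finset.univ) => hterm i j
  -- The first-order terms cancel in pairs: F_ij + F_ji = 1 and the weights are symmetric.
  have hanti : ∑ i, ∑ j, (if i ≠ j then (W.w i j : ℝ) * (g₀ * (F θ i j - F θ₀ i j)) else 0) = 0 := by
    refine sum_sum_eq_zero_of_antisymm fun i j => ?_
    by_cases hij : i = j
    · simp [hij]
    · rw [if_pos hij, if_pos (Ne.symm hij), hWs i j hij]
      have e : ∀ θ, F θ i j = 1 - F θ j i := fun θ => by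
        have := diffCDF_add_neg (π := π) (θ i - θ j)
        rw [neg_sub] at this
        simp only [hF]; linarith
      rw [e θ, e θ₀]; ring
  simp only [Finset.sum_sub_distrib, Finset.sum_add_distrib, ← Finset.mul_sum] at hsum
  rw [hanti, ← hC] at hsum
  rw [compositeLogLik_eq hπ, compositeLogLik_eq hπ] at hL
  have hsq : ∑ i, ∑ j, (if i ≠ j then
      (W.w i j : ℝ) * (g₀ * ((F θ i j - F θ₀ i j) ^ 2 / 4)) else 0) ≤ δ * C := by linarith
  have hnn : ∀ i j, 0 ≤ (if i ≠ j then
      (W.w i j : ℝ) * (g₀ * ((F θ i j - F θ₀ i j) ^ 2 / 4)) else 0) := by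
    intro i j; split_ifs <;> positivity
  have hedge : ∀ i j, i ≠ j → 0 < W.w i j → |(θ i - θ j) - (θ₀ i - θ₀ j)| < ε' := by
    intro i j hij hw
    refine hη _ _ ?_
    by_contra! hcon
    have h1 := (Finset.single_le_sum (fun j _ => hnn i j) (Finset.mem_univ j)).trans
      (Finset.single_le_sum (f := fun i => ∑ j, _)
        (fun i _ => Finset.sum_nonneg fun j _ => hnn i j) (Finset.mem_univ i))
    rw [if_pos hij] at h1
    have h2 := hδ i j hw
    have h3 : η (θ₀ i - θ₀ j) ^ 2 ≤ (F θ i j - F θ₀ i j) ^ 2 := by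
      rw [← sq_abs (F θ i j - F θ₀ i j)]
      exact pow_le_pow_left₀ (hη0 _).le hcon 2
    have h4 : (W.w i j : ℝ) * (g₀ * (η (θ₀ i - θ₀ j) ^ 2 / 4)) ≤
      W.w i j * (g₀ * ((F θ i j - F θ₀ i j) ^ 2 / 4)) := by gcongr
    linarith
  have hadj : ∀ a b, (SimpleGraph.fromRel fun i j => 0 < W.w i j).Adj a b →
      |(θ - θ₀) a - (θ - θ₀) b| ≤ ε' := by
    intro a b hab
    rw [SimpleGraph.fromRel_adj] at hab
    simp only [Pi.sub_apply]
    rcases hab.2 with h | h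
    · have := (hedge a b hab.1 h).le
      rwa [show θ a - θ₀ a - (θ b - θ₀ b) = θ a - θ b - (θ₀ a - θ₀ b) by ring]
    · have := (hedge b a (Ne.symm hab.1) h).le
      rwa [abs_sub_comm, show θ b - θ₀ b - (θ a - θ₀ a) = θ b - θ a - (θ₀ b - θ₀ a) by ring]
  rw [dist_pi_lt_iff hε]
  intro i
  obtain ⟨p, hp⟩ := (hW.preconnected i ⟨m - 1, by lia⟩).exists_isPath
  have h1 := abs_sub_le_of_walk hadj p
  have h2 : (p.length : ℝ) < m + 1 := by
    have := hp.length_lt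
    rw [Fintype.card_fin] at this
    exact_mod_cast this.trans (Nat.lt_succ_self m)
  have hlast : ∀ θ ∈ parameterSpace m, θ ⟨m - 1, by lia⟩ = 0 := fun θ hθ => hθ _ (by
    simp only; lia)
  simp only [Pi.sub_apply, hlast θ hθ, hlast θ₀ hθ₀, sub_zero] at h1
  rw [Real.dist_eq]
  calc _ ≤ _ := h1
    _ < (m + 1) * ε' := by gcongr
    _ = ε := by rw [hε']; field_simp

lemma isClosed_parameterSpace : IsClosed (parameterSpace m) := by
  have : parameterSpace m = ⋂ i : Fin m, ⋂ (_ : i.val + 1 = m), {θ : Fin m → ℝ | θ i = 0} := by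
    ext θ; simp [parameterSpace]
  rw [this]
  exact isClosed_iInter fun i => isClosed_iInter fun _ =>
    isClosed_eq (continuous_apply i) continuous_const

/-- Once the averages are close to their means, the superlevel set of the likelihood at θ₀ lies in a
ball, hence is compact; this yields both existence and location of the maximisers. -/
theorem isConsistent_of_uniform (hm : 0 < m) (hπ : IsUtilityDensity π) {B : ℝ}
    (hB : ∀ x, π x ≤ B) (G : Breaking m) {g₀ : ℝ} (hg₀ : 0 < g₀)
    (hG : ∀ k l, k < l → (G.g k l : ℝ) = g₀) (W : CMLWeights m) (hW : W.Connected)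
    (hWs : W.Symmetric) : IsConsistent (fun _ : Fin m => π) G W := by
  intro θ₀ hθ₀ ε hε
  obtain ⟨δ, hδ, h⟩ := exists_dist_lt_of_likelihood_le hm hπ hB G hg₀ hG W hW hWs hθ₀ hε
  refine tendsto_of_tendsto_of_tendsto_of_le_of_le (tendsto_profileProb_kappa hπ G θ₀ hδ)
    tendsto_const_nhds (fun n => profileProb_mono θ₀ fun P hP => ?_)
    (fun n => profileProb_le_one hπ θ₀ _)
  have hd := h n P hP
  refine ⟨?_, fun θ hθ => hd θ hθ.1 (hθ.2 hθ₀)⟩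
  set K := {θ | θ ∈ parameterSpace m ∧ compositeLogLik (fun _ => π) G W P θ₀ ≤
    compositeLogLik (fun _ => π) G W P θ} with hK
  have hc := continuous_compositeLogLik hπ hB G W P
  have hKc : IsCompact K := by
    refine Metric.isCompact_of_isClosed_isBounded
      (isClosed_parameterSpace.inter (isClosed_le continuous_const hc)) ?_
    exact Metric.isBounded_ball.subset fun θ hθ => hd θ hθ.1 hθ.2
  obtain ⟨θ, hθK, hθ⟩ := hKc.exists_isMaxOn ⟨θ₀, hθ₀, le_rfl⟩ hc.continuousOn
  refine ⟨θ, hθK.1, fun θ' hθ' => ?_⟩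
  rcases le_total (compositeLogLik (fun _ => π) G W P θ₀)
    (compositeLogLik (fun _ => π) G W P θ') with h1 | h1
  · exact hθ ⟨hθ', h1⟩
  · exact h1.trans hθK.2

/-! ### Necessity: connectedness, and stationarity of every ground truth. -/

lemma IsConsistent.eventually_lt {G : Breaking m} {W : CMLWeights m}
    (h : IsConsistent (fun _ : Fin m => π) G W) {θ₀ : Fin m → ℝ} (hθ₀ : θ₀ ∈ parameterSpace m)
    {ε : ℝ} (hε : 0 < ε) {c : ℝ} (hc : c < 1) :
    ∀ᶠ n : ℕ in atTop, c < profileProb (fun _ => π) θ₀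
      {P : Profile m n | (rbcml (fun _ => π) G W P).Nonempty ∧
        ∀ θ ∈ rbcml (fun _ => π) G W P, dist θ θ₀ < ε} :=
  (h θ₀ hθ₀ ε hε).eventually (lt_mem_nhds hc)

lemma zero_mem_parameterSpace : (0 : Fin m → ℝ) ∈ parameterSpace m := fun _ _ => rfl

/-- Raising by one all alternatives not joined to the last one changes no difference along an edge.
So maximisers come in pairs one apart, and both cannot lie within 1/2 of the origin. -/
lemma connected_of_isConsistent (hm : 0 < m) (hπ : IsUtilityDensity π) {G : Breaking m}
    {W : CMLWeights m} (h : IsConsistent (fun _ : Fin m => π) G W) : W.Connected := by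
  classical
  set H := SimpleGraph.fromRel fun i j => 0 < W.w i j with hH
  set z : Fin m := ⟨m - 1, by lia⟩ with hz
  by_contra hcon
  obtain ⟨v, hv⟩ : ∃ v, ¬ H.Reachable v z := by
    by_contra! hall
    have : Nonempty (Fin m) := ⟨z⟩
    exact hcon ⟨fun a b => (hall a).trans (hall b).symm⟩
  obtain ⟨n, hn⟩ := (h.eventually_lt zero_mem_parameterSpace (ε := 1 / 2) (by norm_num)
    (c := 0) one_pos).exists
  obtain ⟨P, ⟨⟨θ, hθ⟩, hall⟩⟩ : {P : Profile m n | (rbcml (fun _ => π) G W P).Nonempty ∧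
        ∀ θ ∈ rbcml (fun _ => π) G W P, dist θ 0 < 1 / 2}.Nonempty := by
    by_contra hne
    rw [Set.not_nonempty_iff_eq_empty.1 hne] at hn
    simp [profileProb] at hn
  set θ' : Fin m → ℝ := fun i => θ i + if H.Reachable i z then 0 else 1 with hθ'
  have hlik : compositeLogLik (fun _ => π) G W P θ' = compositeLogLik (fun _ => π) G W P θ := by
    rw [compositeLogLik_eq hπ, compositeLogLik_eq hπ]
    refine Finset.sum_congr rfl fun i _ => Finset.sum_congr rfl fun j _ => ?_
    split_ifs with hij
    · rcases (zero_le (a := W.w i j)).eq_or_lt with hw | hw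
      · simp [← hw]
      · have hadj : H.Adj i j := (SimpleGraph.fromRel_adj _ _ _).2 ⟨hij, Or.inl hw⟩
        have : H.Reachable i z ↔ H.Reachable j z :=
          ⟨fun h => hadj.symm.reachable.trans h, fun h => hadj.reachable.trans h⟩
        simp only [hθ', this, add_sub_add_right_eq_sub]
    · rfl
  have hmem : θ' ∈ rbcml (fun _ => π) G W P := by
    refine ⟨fun i hi => ?_, fun θ'' h'' => ?_⟩
    · have hiz : i = z := Fin.ext (by simp only [hz]; lia)
      have h0 := hθ.1 i hi
      rw [hiz] at h0 ⊢
      simp [hθ', h0]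
    · change _ ≤ compositeLogLik _ G W P θ'
      rw [hlik]; exact hθ.2 h''
  have h1 := (dist_le_pi_dist θ' 0 v).trans_lt (hall _ hmem)
  have h2 := (dist_le_pi_dist θ 0 v).trans_lt (hall _ hθ)
  rw [Pi.zero_apply, Real.dist_0_eq_abs, abs_lt] at h1 h2
  simp only [hθ', if_neg hv] at h1
  linarith [h1.2, h2.1]

/-- The composite log-likelihood with prescribed weights of the comparisons. -/
def logLik (π : ℝ → ℝ) (W : CMLWeights m) (κ : Fin m → Fin m → ℝ) (θ : Fin m → ℝ) : ℝ :=
  ∑ i, ∑ j, if i ≠ j then κ i j * (W.w i j : ℝ) * Real.log (diffCDF π (θ i - θ j)) else 0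

lemma continuous_logLik (hπ : IsUtilityDensity π) {B : ℝ} (hB : ∀ x, π x ≤ B) (W : CMLWeights m) :
    Continuous fun z : (Fin m → Fin m → ℝ) × (Fin m → ℝ) => logLik π W z.1 z.2 := by
  refine continuous_finsetSum _ fun i _ => continuous_finsetSum _ fun j _ => ?_
  split_ifs
  · exact Continuous.mul (by fun_prop) (((continuous_diffCDF hπ hB).comp (by fun_prop)).log
      fun θ => (diffCDF_pos hπ hB _).ne')
  · exact continuous_const

lemma logLik_add_const (W : CMLWeights m) (κ : Fin m → Fin m → ℝ) (θ : Fin m → ℝ) (c : ℝ) :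
    logLik π W κ (fun i => θ i + c) = logLik π W κ θ := by
  simp only [logLik, add_sub_add_right_eq_sub]

/-- Under consistency the ground truth maximises the expected log-likelihood. -/
lemma logLik_mean_le_of_mem (hπ : IsUtilityDensity π) {B : ℝ} (hB : ∀ x, π x ≤ B) {G : Breaking m}
    {W : CMLWeights m} (h : IsConsistent (fun _ : Fin m => π) G W) {θ₀ θ : Fin m → ℝ}
    (hθ₀ : θ₀ ∈ parameterSpace m) (hθ : θ ∈ parameterSpace m) :
    logLik π W (G.mean π θ₀) θ ≤ logLik π W (G.mean π θ₀) θ₀ := by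
  by_contra! hlt
  have hc := continuous_logLik hπ hB W
  -- A strict failure persists for frequencies near the means and parameters near θ₀, so a maximiser
  -- near θ₀ would be beaten by θ.
  have hopen : ∀ᶠ z in 𝓝 (G.mean π θ₀, θ₀), logLik π W z.1 z.2 < logLik π W z.1 θ :=
    hc.continuousAt.eventually_lt
      (hc.comp (by fun_prop : Continuous fun z : (Fin m → Fin m → ℝ) × (Fin m → ℝ) =>
        (z.1, θ))).continuousAt hlt
  obtain ⟨δ, hδ, hball⟩ := Metric.eventually_nhds_iff.1 hopen
  -- Two events of probability above 2/3 intersect.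
  obtain ⟨n, hn1, hn2⟩ := ((h.eventually_lt hθ₀ hδ (c := 2 / 3) (by norm_num)).and
    ((tendsto_profileProb_kappa hπ G θ₀ hδ).eventually
      (lt_mem_nhds (by norm_num : (2 / 3 : ℝ) < 1)))).exists
  have hnd := fun hd => (profileProb_add_le hπ θ₀ hd).not_gt
    (lt_trans (by norm_num) (add_lt_add hn1 hn2))
  obtain ⟨P, ⟨⟨θ', hθ'⟩, hall⟩, hP⟩ := Set.not_disjoint_iff.1 hnd
  have h1 : logLik π W (kappa G P) θ' < logLik π W (kappa G P) θ := by
    refine hball (y := (kappa G P, θ')) ?_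
    rw [Prod.dist_eq, max_lt_iff]
    refine ⟨?_, hall _ hθ'⟩
    simp only [dist_pi_lt_iff hδ, Real.dist_eq]
    exact hP
  have h2 : compositeLogLik (fun _ => π) G W P θ ≤ compositeLogLik (fun _ => π) G W P θ' :=
    hθ'.2 hθ
  rw [compositeLogLik_eq hπ, compositeLogLik_eq hπ] at h2
  exact h1.not_ge h2

/-- Translation invariance removes the normalisation, so every coordinate, including the last, may
be varied. -/
lemma logLik_mean_le (hm : 0 < m) (hπ : IsUtilityDensity π) {B : ℝ} (hB : ∀ x, π x ≤ B)
    {G : Breaking m} {W : CMLWeights m} (h : IsConsistent (fun _ : Fin m => π) G W)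
    (θ₀ θ : Fin m → ℝ) : logLik π W (G.mean π θ₀) θ ≤ logLik π W (G.mean π θ₀) θ₀ := by
  have hmem : ∀ θ : Fin m → ℝ, (fun i => θ i + -θ ⟨m - 1, by lia⟩) ∈ parameterSpace m := by
    intro θ i hi
    have : i = ⟨m - 1, by lia⟩ := Fin.ext (by simp only; lia)
    rw [this]; ring
  have h1 := logLik_mean_le_of_mem hπ hB h (hmem θ₀) (hmem θ)
  rw [logLik_add_const, logLik_add_const] at h1
  have h2 : G.mean π (fun i => θ₀ i + -θ₀ ⟨m - 1, by lia⟩) = G.mean π θ₀ := by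
    funext i j; exact mean_add_const G θ₀ _ i j
  rwa [h2] at h1

/-- The expected weight of the comparisons "`i` is preferred to `j`" relative to the probability
that `i` is preferred to `j`. -/
def Breaking.ratio (π : ℝ → ℝ) (G : Breaking m) (θ : Fin m → ℝ) (i j : Fin m) : ℝ :=
  G.mean π θ i j / diffCDF π (θ i - θ j)

/-- Every ground truth is a stationary point of the expected log-likelihood. -/
def Stationary (π : ℝ → ℝ) (G : Breaking m) (W : CMLWeights m) : Prop :=
  ∀ (θ : Fin m → ℝ) (k : Fin m), ∑ i, (if i ≠ k then diffPDF π (θ k - θ i) *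
    (W.w k i * G.ratio π θ k i - W.w i k * G.ratio π θ i k) else 0) = 0

lemma stationary_of_isConsistent (hm : 0 < m) (hπ : IsUtilityDensity π) {B : ℝ}
    (hB : ∀ x, π x ≤ B) {G : Breaking m} {W : CMLWeights m}
    (h : IsConsistent (fun _ : Fin m => π) G W) : Stationary π G W := by
  intro θ k
  set e : Fin m → ℝ := Pi.single k 1 with he
  set c : Fin m → Fin m → ℝ := fun i j => if i ≠ j then G.mean π θ i j * W.w i j *
    (diffPDF π (θ i - θ j) / diffCDF π (θ i - θ j)) else 0 with hc
  have hd : HasDerivAt (fun t : ℝ => logLik π W (G.mean π θ) (fun i => θ i + t * e i))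
      (∑ i, ∑ j, c i j * (e i - e j)) 0 := by
    refine HasDerivAt.fun_sum fun i _ => HasDerivAt.fun_sum fun j _ => ?_
    simp only [hc]
    split_ifs with hij
    · have h1 : HasDerivAt (fun t : ℝ => θ i + t * e i - (θ j + t * e j)) (e i - e j) 0 := by
        have := (((hasDerivAt_id (0 : ℝ)).mul_const (e i)).const_add (θ i)).fun_sub
          (((hasDerivAt_id (0 : ℝ)).mul_const (e j)).const_add (θ j))
        simpa using this
      have h2 := HasDerivAt.scomp_of_eq (0 : ℝ) (hasDerivAt_diffCDF hπ hB (θ i - θ j)) h1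
        (by simp)
      have h3 := (h2.log (by simpa using (diffCDF_pos hπ hB _).ne')).const_mul
        (G.mean π θ i j * W.w i j)
      refine h3.congr_deriv ?_
      simp
      ring
    · simpa using hasDerivAt_const (0 : ℝ) (0 : ℝ)
  have hmax : IsLocalMax (fun t : ℝ => logLik π W (G.mean π θ) (fun i => θ i + t * e i)) 0 := by
    refine Eventually.of_forall fun t => ?_
    simpa using logLik_mean_le hm hπ hB h θ (fun i => θ i + t * e i)
  have h0 := hmax.hasDerivAt_eq_zero hd
  have h1 : ∑ i, ∑ j, c i j * (e i - e j) = ∑ i, (c k i - c i k) := by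
    simp only [mul_sub, Finset.sum_sub_distrib]
    congr 1
    · rw [Finset.sum_eq_single k]
      · simp [he]
      · intro i _ hi; simp [he, hi]
      · simp
    · refine Finset.sum_congr rfl fun i _ => ?_
      rw [Finset.sum_eq_single k]
      · simp [he]
      · intro j _ hj; simp [he, hj]
      · simp
  rw [h1] at h0
  refine Eq.trans (Finset.sum_congr rfl fun i _ => ?_) h0
  simp only [hc, Breaking.ratio]
  by_cases hik : i = k
  · simp [hik]
  · rw [if_pos hik, if_pos hik, if_pos (Ne.symm hik), ← neg_sub (θ k) (θ i), diffPDF_neg]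
    ring

/-! ### Reversal symmetry. -/

/-- The breaking that extracts from a ranking what `G` extracts from the reversed ranking. -/
def Breaking.rev (G : Breaking m) : Breaking m := ⟨fun k l => G.g l.rev k.rev⟩

/-- The weights with all pairs reversed. -/
def CMLWeights.swap (W : CMLWeights m) : CMLWeights m := ⟨fun i j => W.w j i⟩

/-- Injectivity is needed: with ties, counting strictly larger utilities does not mirror under
negation. -/
lemma extract_rev (G : Breaking m) {u : Fin m → ℝ} (hu : Function.Injective u) (i j : Fin m) :
    G.rev.extract (-u) i j = G.extract u j i := by
  obtain ⟨R, hR⟩ := exists_ranking hu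
  have hR' : StrictAnti fun k => (-u) ((Fin.revPerm.trans R) k) := by
    intro a b hab
    have := hR (Fin.rev_lt_rev.2 hab)
    simpa using this
  rw [extract_eq_comparisons _ hR', extract_eq_comparisons _ hR]
  simp [Breaking.comparisons, Breaking.rev]

lemma mean_rev (hπ : IsUtilityDensity π) (hsymm : ∀ x, π (-x) = π x) (G : Breaking m)
    (θ : Fin m → ℝ) (i j : Fin m) : G.rev.mean π (-θ) i j = G.mean π θ j i := by
  have := isProbabilityMeasure_noise hπ
  have hmeas : Measurable fun x : Fin m → ℝ => G.rev.extract (-θ + x) i j :=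
    (measurable_extract G.rev i j).comp (by fun_prop)
  rw [Breaking.mean, ← noiseLaw_map_neg hπ hsymm, integral_map (by fun_prop)
    hmeas.aestronglyMeasurable]
  refine integral_congr_ae ?_
  filter_upwards [ae_injective θ] with x hx
  rw [← extract_rev G hx, neg_add]

/-- Negating locations and noises preserves the noise law and reverses every ranking. -/
lemma Stationary.rev (hπ : IsUtilityDensity π) (hsymm : ∀ x, π (-x) = π x) {G : Breaking m}
    {W : CMLWeights m} (h : Stationary π G W) : Stationary π G.rev W.swap := by
  intro θ k
  have h1 := h (-θ) k
  rw [← neg_eq_zero, ← Finset.sum_neg_distrib] at h1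
  refine Eq.trans (Finset.sum_congr rfl fun i _ => ?_) h1
  have hr : ∀ i j, G.rev.ratio π θ i j = G.ratio π (-θ) j i := by
    intro i j
    have := mean_rev hπ hsymm G (-θ) i j
    rw [neg_neg] at this
    rw [Breaking.ratio, Breaking.ratio, this]
    congr 2
    simp only [Pi.neg_apply]; ring
  have e : (-θ) k - (-θ) i = -(θ k - θ i) := by simp only [Pi.neg_apply]; ring
  rw [hr, hr, e, diffPDF_neg]
  simp only [CMLWeights.swap]
  split_ifs <;> ring

/-! ### Spread configurations and the limit of the stationarity equation. -/

/-- The locations of a configuration in which `k` lies `T` below `j`, the alternatives of `A` lie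
one above `j`, those of `D` lie `T` above `j`, and all others lie `2 T` below `k`. -/
def spread (j k : Fin m) (A D : Finset (Fin m)) (T : ℕ) (i : Fin m) : ℝ :=
  if i = j then 0 else if i = k then -T else if i ∈ A then 1 else if i ∈ D then T else -(3 * T)

/-- The disjointness of the roles in a configuration. -/
structure IsSpread (j k : Fin m) (A D : Finset (Fin m)) : Prop where
  ne : j ≠ k
  left_notMem_near : j ∉ A
  left_notMem_far : j ∉ D
  right_notMem_near : k ∉ A
  right_notMem_far : k ∉ D
  disjoint : Disjoint A D

section Spread

variable {j k : Fin m} {A D : Finset (Fin m)}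

@[simp] lemma spread_left (T : ℕ) : spread j k A D T j = 0 := by simp [spread]

lemma IsSpread.right (h : IsSpread j k A D) (T : ℕ) : spread j k A D T k = -T := by
  simp [spread, h.ne.symm]

lemma IsSpread.cases (h : IsSpread j k A D) (T : ℕ) (i : Fin m) :
    (i = j ∧ i ∉ A ∧ i ∉ D ∧ i ≠ k ∧ spread j k A D T i = 0) ∨
    (i = k ∧ i ∉ A ∧ i ∉ D ∧ i ≠ j ∧ spread j k A D T i = -T) ∨
    (i ≠ j ∧ i ≠ k ∧ i ∈ A ∧ i ∉ D ∧ spread j k A D T i = 1) ∨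
    (i ≠ j ∧ i ≠ k ∧ i ∉ A ∧ i ∈ D ∧ spread j k A D T i = T) ∨
    (i ≠ j ∧ i ≠ k ∧ i ∉ A ∧ i ∉ D ∧ spread j k A D T i = -(3 * T)) := by
  by_cases hj : i = j
  · subst hj
    exact Or.inl ⟨rfl, h.left_notMem_near, h.left_notMem_far, h.ne, by simp⟩
  by_cases hk : i = k
  · subst hk
    exact Or.inr (Or.inl ⟨rfl, h.right_notMem_near, h.right_notMem_far, hj, h.right T⟩)
  by_cases hA : i ∈ A
  · exact Or.inr (Or.inr (Or.inl ⟨hj, hk, hA, Finset.disjoint_left.1 h.disjoint hA,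
      by simp [spread, hj, hk, hA]⟩))
  by_cases hD : i ∈ D
  · exact Or.inr (Or.inr (Or.inr (Or.inl ⟨hj, hk, hA, hD, by simp [spread, hj, hk, hA, hD]⟩)))
  · exact Or.inr (Or.inr (Or.inr (Or.inr ⟨hj, hk, hA, hD, by simp [spread, hj, hk, hA, hD]⟩)))

/-- The number of alternatives of `A` that end up above `j`. -/
def nearCount (j : Fin m) (A : Finset (Fin m)) (x : Fin m → ℝ) : ℕ :=
  (A.filter fun l => x j < 1 + x l).card

lemma measurable_nearCount (j : Fin m) (A : Finset (Fin m)) : Measurable (nearCount j A) := by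
  unfold nearCount
  simp only [Finset.card_filter]
  refine Finset.measurable_fun_sum _ fun l _ => ?_
  exact Measurable.ite (measurableSet_lt (by fun_prop) (by fun_prop)) measurable_const
    measurable_const

lemma IsSpread.card_union (h : IsSpread j k A D) : (A ∪ D).card = A.card + D.card :=
  Finset.card_union_of_disjoint h.disjoint

/-- When T exceeds the scale of the noises, the groups are separated and only the order of j
relative to A (and within groups) is random. -/
lemma IsSpread.extract_typical (h : IsSpread j k A D) (G : Breaking m) (x : Fin m → ℝ) {T : ℕ}
    {M : ℝ} (hM : ∀ i, |x i| ≤ M) (hT : 2 * M + 1 < T) :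
    G.extract (spread j k A D T + x) j k =
      G.gNat (D.card + nearCount j A x) (A.card + D.card + 1) := by
  have hM' := fun i => abs_le.1 (hM i)
  have hMj := hM' j
  have hMk := hM' k
  have hTk := h.right T
  have hlt : (spread j k A D T + x) k < (spread j k A D T + x) j := by
    simp only [Pi.add_apply, hTk, spread_left]; linarith
  have h1 : (Finset.univ.filter fun l => (spread j k A D T + x) j < (spread j k A D T + x) l) =
      D ∪ A.filter fun l => x j < 1 + x l := by
    ext l
    have hl := hM' l
    simp only [Finset.mem_filter, Finset.mem_univ, true_and, Finset.mem_union, Pi.add_apply,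
      spread_left, zero_add]
    rcases h.cases T l with ⟨h1, h2, h3, h4, h5⟩ | ⟨h1, h2, h3, h4, h5⟩ | ⟨h1, h2, h3, h4, h5⟩ |
      ⟨h1, h2, h3, h4, h5⟩ | ⟨h1, h2, h3, h4, h5⟩ <;> rw [h5]
    · subst h1; simp [h2, h3]
    · simp only [h2, h3, false_and, or_self, iff_false, not_lt]; linarith
    · simp [h3, h4]
    · simp only [h4, true_or, iff_true]; linarith
    · simp only [h3, h4, false_and, or_self, iff_false, not_lt]; linarith
  have h2 : (Finset.univ.filter fun l => (spread j k A D T + x) k < (spread j k A D T + x) l) =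
      insert j (A ∪ D) := by
    ext l
    have hl := hM' l
    simp only [Finset.mem_filter, Finset.mem_univ, true_and, Finset.mem_union, Pi.add_apply,
      hTk, Finset.mem_insert]
    rcases h.cases T l with ⟨h1, h2, h3, h4, h5⟩ | ⟨h1, h2, h3, h4, h5⟩ | ⟨h1, h2, h3, h4, h5⟩ |
      ⟨h1, h2, h3, h4, h5⟩ | ⟨h1, h2, h3, h4, h5⟩ <;> rw [h5]
    · simp only [h1, true_or, iff_true]; linarith
    · subst h1; simp [h2, h3, h4]
    · simp only [h3, true_or, or_true, iff_true]; linarith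
    · simp only [h4, or_true, iff_true]; linarith
    · simp only [h1, h3, h4, or_self, iff_false, not_lt]; linarith
  rw [Breaking.extract, if_pos hlt, cnt, cnt, h1, h2, Finset.card_insert_of_notMem
    (by simp [h.left_notMem_near, h.left_notMem_far]), h.card_union,
    Finset.card_union_of_disjoint (h.disjoint.symm.mono_right (Finset.filter_subset _ _))]
  rfl

/-- The hypotheses put both utilities between M - T and -M, above all bystanders near -3T and below
A and D, so k and j are adjacent. -/
lemma IsSpread.extract_rare (h : IsSpread j k A D) (G : Breaking m) (x : Fin m → ℝ) {T : ℕ}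
    {M : ℝ} (hM : ∀ i, i ≠ j → i ≠ k → |x i| < M) (hk : x k < T - M) (hj : M - T < x j)
    (hlt : x j < x k - T) :
    G.extract (spread j k A D T + x) k j = G.gNat (A.card + D.card) (A.card + D.card + 1) := by
  have hM' := fun i hij hik => abs_lt.1 (hM i hij hik)
  have hTk := h.right T
  have hT0 : (0 : ℝ) ≤ T := T.cast_nonneg
  have h1 : (Finset.univ.filter fun l => (spread j k A D T + x) k < (spread j k A D T + x) l) =
      A ∪ D := by
    ext l
    simp only [Finset.mem_filter, Finset.mem_univ, true_and, Finset.mem_union, Pi.add_apply,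
      hTk]
    rcases h.cases T l with ⟨h1, h2, h3, h4, h5⟩ | ⟨h1, h2, h3, h4, h5⟩ | ⟨h1, h2, h3, h4, h5⟩ |
      ⟨h1, h2, h3, h4, h5⟩ | ⟨h1, h2, h3, h4, h5⟩ <;> rw [h5]
    · subst h1; simp only [h2, h3, or_self, iff_false, not_lt]; linarith
    · subst h1; simp [h2, h3]
    · have := hM' l h1 h2
      simp only [h3, true_or, iff_true]; linarith
    · have := hM' l h1 h2
      simp only [h4, or_true, iff_true]; linarith
    · have := hM' l h1 h2
      simp only [h3, h4, or_self, iff_false, not_lt]; linarith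
  have h2 : (Finset.univ.filter fun l => (spread j k A D T + x) j < (spread j k A D T + x) l) =
      insert k (A ∪ D) := by
    ext l
    simp only [Finset.mem_filter, Finset.mem_univ, true_and, Finset.mem_union, Pi.add_apply,
      spread_left, zero_add, Finset.mem_insert]
    rcases h.cases T l with ⟨h1, h2, h3, h4, h5⟩ | ⟨h1, h2, h3, h4, h5⟩ | ⟨h1, h2, h3, h4, h5⟩ |
      ⟨h1, h2, h3, h4, h5⟩ | ⟨h1, h2, h3, h4, h5⟩ <;> rw [h5]
    · subst h1; simp [h2, h3, h4]
    · subst h1; simp only [true_or, iff_true]; linarith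
    · have := hM' l h1 h2
      simp only [h3, true_or, or_true, iff_true]; linarith
    · have := hM' l h1 h2
      simp only [h4, or_true, iff_true]; linarith
    · have := hM' l h1 h2
      simp only [h2, h3, h4, or_self, iff_false, not_lt]; linarith
  rw [Breaking.extract, if_pos (by simp only [Pi.add_apply, hTk, spread_left]; linarith), cnt, cnt,
    h1, h2, Finset.card_insert_of_notMem (by simp [h.right_notMem_near, h.right_notMem_far]),
    h.card_union]

lemma IsSpread.tendsto_ratio_typical [IsProbabilityMeasure (noise π)] (h : IsSpread j k A D)
    (G : Breaking m) :
    Tendsto (fun T : ℕ => G.ratio π (spread j k A D T) j k) atTop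
      (𝓝 (∫ x, G.gNat (D.card + nearCount j A x) (A.card + D.card + 1) ∂(noiseLaw m π))) := by
  obtain ⟨C, hC⟩ := exists_gNat_le G
  have hmean : Tendsto (fun T : ℕ => G.mean π (spread j k A D T) j k) atTop
      (𝓝 (∫ x, G.gNat (D.card + nearCount j A x) (A.card + D.card + 1) ∂(noiseLaw m π))) := by
    refine tendsto_integral_of_dominated_convergence (fun _ => C)
      (fun T => (integrable_extract G _ j k).aestronglyMeasurable) (integrable_const C)
      (fun T => ae_of_all _ fun x => ?_) (ae_of_all _ fun x => ?_)
    · rw [Real.norm_of_nonneg (extract_nonneg _ _ _ _)]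
      exact extract_le G hC _ _ _
    · refine tendsto_const_nhds.congr' ?_
      have hM : ∀ i, |x i| ≤ ∑ l, |x l| := fun i =>
        Finset.single_le_sum (f := fun l => |x l|) (fun _ _ => abs_nonneg _) (Finset.mem_univ i)
      filter_upwards [tendsto_natCast_atTop_atTop.eventually_gt_atTop (2 * (∑ l, |x l|) + 1)]
        with T hT
      exact (h.extract_typical G x hM hT).symm
  have hF : Tendsto (fun T : ℕ => diffCDF π (spread j k A D T j - spread j k A D T k)) atTop
      (𝓝 1) := by
    simp only [spread_left, h.right, zero_sub, neg_neg]
    exact tendsto_diffCDF_atTop.comp tendsto_natCast_atTop_atTop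
  have hdiv := hmean.div hF one_ne_zero
  rw [div_one] at hdiv
  exact hdiv

lemma noiseLaw_indep [IsProbabilityMeasure (noise π)] {i j k : Fin m} (hij : i ≠ j) (hik : i ≠ k)
    {s : Set ℝ} {t : Set (ℝ × ℝ)} (hs : MeasurableSet s) (ht : MeasurableSet t) :
    (noiseLaw m π).real {x | x i ∈ s ∧ (x k, x j) ∈ t} =
      (noise π).real s * (noiseLaw m π).real {x | (x k, x j) ∈ t} := by
  have h := ProbabilityTheory.iIndepFun_pi (μ := fun _ : Fin m => noise π)
    (X := fun _ x => x) (fun i => by fun_prop)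
  have h2 := (h.indepFun_prodMk (fun i => measurable_pi_apply i) k j i hik.symm hij.symm).symm
  have h3 := h2.measure_inter_preimage_eq_mul s t hs ht
  have h4 : noise π s = (noiseLaw m π) ((fun x => x i) ⁻¹' s) := by
    rw [← Measure.map_apply (by fun_prop) hs, noiseLaw_map_eval]
  rw [measureReal_def, measureReal_def, measureReal_def, h4, ← ENNReal.toReal_mul]
  exact congrArg ENNReal.toReal h3

lemma noiseLaw_eval_real [IsProbabilityMeasure (noise π)] (i : Fin m) {s : Set ℝ}
    (hs : MeasurableSet s) : (noiseLaw m π).real {x | x i ∈ s} = (noise π).real s := by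
  rw [← noiseLaw_map_eval (m := m) i, map_measureReal_apply (by fun_prop) hs]
  rfl

lemma noise_real_Iic_neg (hπ : IsUtilityDensity π) (hsymm : ∀ x, π (-x) = π x) (t : ℝ) :
    (noise π).real (Set.Iic (-t)) = (noise π).real (Set.Ici t) := by
  conv_rhs => rw [← noise_map_neg hπ hsymm]
  rw [map_measureReal_apply (by fun_prop) measurableSet_Ici]
  congr 1
  ext x
  simp only [Set.mem_Iic, Set.mem_preimage, Set.mem_Ici]
  exact le_neg

/-- An exceedance by a single noise is much less likely than one by a difference. -/
lemma exists_noise_tail_le_diffCDF (hπ : IsUtilityDensity π) (hsymm : ∀ x, π (-x) = π x)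
    (hdiff : Differentiable ℝ π) (hlim : Tendsto (deriv fun x => Real.log (π x)) atBot atTop)
    (M : ℝ) {ε : ℝ} (hε : 0 < ε) :
    ∃ T₀ : ℝ, ∀ T ≥ T₀, (noise π).real (Set.Ici (T - M)) ≤ ε * diffCDF π (-T) := by
  have := isProbabilityMeasure_noise hπ
  set c := (noise π).real (Set.Iio (-M - 1)) with hc
  have hc0 : 0 < c := ENNReal.toReal_pos
    (noise_pos_of_isOpen hπ isOpen_Iio ⟨-M - 2, by simp only [Set.mem_Iio]; linarith⟩).ne'
    (measure_ne_top _ _)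
  obtain ⟨T₁, hT₁⟩ := exists_noise_tail_le hπ hsymm hdiff hlim (mul_pos hε hc0)
  refine ⟨T₁ + M + 1, fun T hT => ?_⟩
  have h1 := hT₁ (T - M - 1) (by linarith)
  rw [sub_add_cancel] at h1
  -- A noise one unit less extreme, helped by a moderately negative second noise (probability `c`),
  -- already realises the exceedance by a difference.
  have h2 : (noise π).real (Set.Ici (T - M - 1)) * c ≤ diffCDF π (-T) := by
    rw [hc, ← measureReal_prod_prod, diffCDF]
    refine measureReal_mono fun z hz => ?_
    have hz1 : T - M - 1 ≤ z.1 := hz.1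
    have hz2 : z.2 < -M - 1 := hz.2
    change z.2 < z.1 + -T
    linarith
  calc _ ≤ _ := h1
    _ = ε * ((noise π).real (Set.Ici (T - M - 1)) * c) := by ring
    _ ≤ _ := by gcongr

/-- When `k` beats `j` from far below, the two meet in the middle. -/
lemma IsSpread.tendsto_ratio_rare (hπ : IsUtilityDensity π) (hsymm : ∀ x, π (-x) = π x)
    {B : ℝ} (hB : ∀ x, π x ≤ B)
    (hdiff : Differentiable ℝ π) (hlim : Tendsto (deriv fun x => Real.log (π x)) atBot atTop)
    (h : IsSpread j k A D) (G : Breaking m) :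
    Tendsto (fun T : ℕ => G.ratio π (spread j k A D T) k j) atTop
      (𝓝 (G.gNat (A.card + D.card) (A.card + D.card + 1))) := by
  have := isProbabilityMeasure_noise hπ
  obtain ⟨C, hC⟩ := exists_gNat_le G
  set g := G.gNat (A.card + D.card) (A.card + D.card + 1) with hg
  rw [Metric.tendsto_atTop]
  intro ε hε
  -- The bad event below has probability at most (2m + 2)ε'p, with p the probability that k beats j,
  -- and costs at most `C`.
  set ε' : ℝ := ε / ((C + 1) * (2 * m + 3)) with hε'
  have hC0 := hC.1
  have hε'0 : 0 < ε' := by positivity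
  obtain ⟨M, hM⟩ : ∃ M, (noise π).real (Set.Ici M) ≤ ε' := by
    obtain ⟨T, hT⟩ := exists_noise_tail_le hπ hsymm hdiff hlim hε'0
    exact ⟨T + 1, (hT T le_rfl).trans (mul_le_of_le_one_right hε'0.le measureReal_le_one)⟩
  obtain ⟨T₀, hT₀⟩ := exists_noise_tail_le_diffCDF hπ hsymm hdiff hlim M hε'0
  obtain ⟨N, hN⟩ := exists_nat_ge T₀
  refine ⟨N, fun T hT => ?_⟩
  have hTT : (T₀ : ℝ) ≤ T := hN.trans (by exact_mod_cast hT)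
  set p := diffCDF π (-T) with hp
  have hp0 : 0 < p := diffCDF_pos hπ hB _
  have hpk : diffCDF π (spread j k A D T k - spread j k A D T j) = p := by
    rw [h.right, spread_left, sub_zero]
  set lt : Set (Fin m → ℝ) := {x | (x k, x j) ∈ {z : ℝ × ℝ | z.2 < z.1 + -T}} with hlt
  have hltm : MeasurableSet lt := (measurableSet_diff_lt _).preimage (by fun_prop)
  have hltp : (noiseLaw m π).real lt = p := noiseLaw_pair h.ne.symm (measurableSet_diff_lt _)
  set far : Set ℝ := Set.Ici M ∪ Set.Iic (-M) with hfar
  have hfarm : MeasurableSet far := measurableSet_Ici.union measurableSet_Iic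
  have hfarp : (noise π).real far ≤ 2 * ε' := by
    refine (measureReal_union_le _ _).trans ?_
    rw [noise_real_Iic_neg hπ hsymm]; linarith
  -- Either a bystander is far, which is independent of the contest of k and j, or one of k and j
  -- covers almost the whole distance alone, which is negligible against p.
  set bad : Set (Fin m → ℝ) :=
    (⋃ i ∈ Finset.univ.filter (fun i => i ≠ j ∧ i ≠ k),
      {x | x i ∈ far ∧ (x k, x j) ∈ {z : ℝ × ℝ | z.2 < z.1 + -T}}) ∪
    ({x | x k ∈ Set.Ici (T - M)} ∪ {x | x j ∈ Set.Iic (-(T - M))}) with hbad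
  have hbadp : (noiseLaw m π).real bad ≤ (2 * m + 2) * ε' * p := by
    have h1 : (noiseLaw m π).real (⋃ i ∈ Finset.univ.filter (fun i => i ≠ j ∧ i ≠ k),
        {x | x i ∈ far ∧ (x k, x j) ∈ {z : ℝ × ℝ | z.2 < z.1 + -T}}) ≤ m * (2 * ε' * p) := by
      refine (measureReal_biUnion_finset_le _ _).trans ?_
      refine (Finset.sum_le_card_nsmul _ _ (2 * ε' * p) fun i hi => ?_).trans ?_
      · simp only [Finset.mem_filter, Finset.mem_univ, true_and] at hi
        rw [noiseLaw_indep hi.1 hi.2 hfarm (measurableSet_diff_lt _)]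
        change (noise π).real far * (noiseLaw m π).real lt ≤ _
        rw [hltp]; gcongr
      · rw [nsmul_eq_mul]
        gcongr
        exact (Finset.card_le_univ _).trans (by simp)
    have h2 : (noiseLaw m π).real {x : Fin m → ℝ | x k ∈ Set.Ici (T - M)} ≤ ε' * p := by
      rw [noiseLaw_eval_real k measurableSet_Ici]; exact hT₀ T hTT
    have h3 : (noiseLaw m π).real {x : Fin m → ℝ | x j ∈ Set.Iic (-(T - M))} ≤ ε' * p := by
      rw [noiseLaw_eval_real j measurableSet_Iic, noise_real_Iic_neg hπ hsymm]; exact hT₀ T hTT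
    have h4 := measureReal_union_le (μ := noiseLaw m π)
      {x : Fin m → ℝ | x k ∈ Set.Ici (T - M)} {x : Fin m → ℝ | x j ∈ Set.Iic (-(T - M))}
    have h5 := (measureReal_union_le (μ := noiseLaw m π) _ _).trans (add_le_add h1 h4)
    linarith
  have hbadm : MeasurableSet bad := by
    refine (Finset.measurableSet_biUnion _ fun i _ => ?_).union
      ((measurableSet_Ici.preimage (measurable_pi_apply k)).union
        (measurableSet_Iic.preimage (measurable_pi_apply j)))
    exact (hfarm.preimage (measurable_pi_apply i)).inter hltm
  have hgC : 0 ≤ g ∧ g ≤ C := ⟨gNat_nonneg _ _ _, hC.2 _ _⟩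
  have hpt : ∀ x : Fin m → ℝ, ‖G.extract (spread j k A D T + x) k j - lt.indicator (fun _ => g) x‖ ≤
      bad.indicator (fun _ => C) x := by
    intro x
    have hnn : 0 ≤ bad.indicator (fun _ => C) x := Set.indicator_nonneg (fun _ _ => hC.1) x
    by_cases hx : x ∈ lt
    · rw [Set.indicator_of_mem hx]
      by_cases hxb : x ∈ bad
      · rw [Set.indicator_of_mem hxb, Real.norm_eq_abs, abs_le]
        have h1 := extract_nonneg G (spread j k A D T + x) k j
        have h2 := extract_le G hC (spread j k A D T + x) k j
        constructor <;> linarith [hgC.1, hgC.2]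
      · have hxlt : x j < x k - T := by
          have : x j < x k + -T := hx
          linarith
        have hxb' : (∀ i, i ≠ j → i ≠ k → |x i| < M) ∧ x k < T - M ∧ M - T < x j := by
          simp only [hbad, Set.mem_union, not_or, Set.mem_iUnion, Finset.mem_filter,
            Finset.mem_univ, true_and, not_exists, Set.mem_ofPred_eq, Set.mem_Ici, Set.mem_Iic,
            not_le, not_and, hfar] at hxb
          refine ⟨fun i hij hik => ?_, hxb.2.1, by linarith [hxb.2.2]⟩
          by_contra! hcon
          refine hxb.1 i ⟨hij, hik⟩ ?_ hx
          rcases le_abs.1 hcon with h | h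
          · exact Or.inl h
          · exact Or.inr (by linarith)
        rw [h.extract_rare G x hxb'.1 hxb'.2.1 hxb'.2.2 hxlt, ← hg, sub_self, norm_zero]
        exact hnn
    · rw [Set.indicator_of_notMem hx, Breaking.extract, if_neg]
      · simpa using hnn
      · intro hcon
        apply hx
        simp only [Pi.add_apply, h.right, spread_left] at hcon
        change x j < x k + -T
        linarith
  have hmain : |G.mean π (spread j k A D T) k j - g * p| ≤ C * ((2 * m + 2) * ε' * p) := by
    have e1 : g * p = ∫ x, lt.indicator (fun _ => g) x ∂(noiseLaw m π) := by
      rw [integral_indicator_const _ hltm, hltp, smul_eq_mul, mul_comm]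
    rw [e1, Breaking.mean, ← integral_sub (integrable_extract G _ k j)
      ((integrable_const g).indicator hltm), ← Real.norm_eq_abs]
    refine (norm_integral_le_of_norm_le ((integrable_const C).indicator hbadm)
      (ae_of_all _ hpt)).trans ?_
    rw [integral_indicator_const _ hbadm, smul_eq_mul, mul_comm]
    gcongr
  rw [Real.dist_eq, Breaking.ratio, hpk]
  have e2 : G.mean π (spread j k A D T) k j / p - g =
      (G.mean π (spread j k A D T) k j - g * p) / p := by field_simp
  rw [e2, abs_div, abs_of_pos hp0, div_lt_iff₀ hp0]
  refine hmain.trans_lt ?_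
  have e3 : ε = (C + 1) * (2 * m + 3) * ε' := by rw [hε']; field_simp
  rw [e3]
  have : C * (2 * m + 2) < (C + 1) * (2 * m + 3) := by nlinarith
  nlinarith [mul_lt_mul_of_pos_right this (mul_pos hε'0 hp0)]

lemma ratio_nonneg (hπ : IsUtilityDensity π) {B : ℝ} (hB : ∀ x, π x ≤ B) (G : Breaking m)
    (θ : Fin m → ℝ) (i l : Fin m) : 0 ≤ G.ratio π θ i l :=
  div_nonneg (mean_nonneg _ _ _ _) (diffCDF_pos hπ hB _).le

lemma ratio_le (hπ : IsUtilityDensity π) {B : ℝ} (hB : ∀ x, π x ≤ B) (G : Breaking m) {C : ℝ}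
    (hC : 0 ≤ C ∧ ∀ a b, G.gNat a b ≤ C) (θ : Fin m → ℝ) {i l : Fin m} (hil : i ≠ l) :
    G.ratio π θ i l ≤ C := by
  have := isProbabilityMeasure_noise hπ
  rw [Breaking.ratio, div_le_iff₀ (diffCDF_pos hπ hB _)]
  exact mean_le G hC θ hil

/-- In the stationarity equation of `k` the term of `j` dominates. -/
lemma IsSpread.tendsto_stationary (hπ : IsUtilityDensity π) (hsymm : ∀ x, π (-x) = π x)
    {B : ℝ} (hB : ∀ x, π x ≤ B)
    (hdiff : Differentiable ℝ π) (hlim : Tendsto (deriv fun x => Real.log (π x)) atBot atTop)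
    (h : IsSpread j k A D) {G : Breaking m} {W : CMLWeights m} (hs : Stationary π G W) :
    Tendsto (fun T : ℕ => W.w k j * G.ratio π (spread j k A D T) k j -
      W.w j k * G.ratio π (spread j k A D T) j k) atTop (𝓝 0) := by
  obtain ⟨C, hC⟩ := exists_gNat_le G
  have hC0 := hC.1
  set S : ℝ := ∑ i, ((W.w k i : ℝ) + W.w i k) * C with hS
  have hS0 : 0 ≤ S := by positivity
  rw [Metric.tendsto_atTop]
  intro ε hε
  -- Alternative j is at distance T from k, those of A at T + 1, and the rest at 2T = T + 1 + (T -
  -- 1).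
  obtain ⟨T₀, hT₀⟩ := exists_diffPDF_far_le hπ hsymm hB hdiff hlim
    (ε := ε / (S + 1)) (by positivity)
  obtain ⟨N, hN⟩ := exists_nat_ge T₀
  -- Starting at N + 1 ensures T ≥ 1, so the natural subtraction T - 1 is not truncated.
  refine ⟨N + 1, fun T hT => ?_⟩
  have hTT : (T₀ : ℝ) ≤ T := hN.trans (by exact_mod_cast (Nat.le_succ N).trans hT)
  set θ := spread j k A D T with hθ
  set f := diffPDF π T with hf
  have hf0 : 0 < f := diffPDF_pos hπ hB _
  set X : Fin m → ℝ := fun i => W.w k i * G.ratio π θ k i - W.w i k * G.ratio π θ i k with hX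
  have hXb : ∀ i, i ≠ k → |X i| ≤ ((W.w k i : ℝ) + W.w i k) * C := by
    intro i hik
    have h1 : W.w k i * G.ratio π θ k i ≤ W.w k i * C :=
      mul_le_mul_of_nonneg_left (ratio_le hπ hB G hC θ (Ne.symm hik)) (W.w k i).coe_nonneg
    have h2 : W.w i k * G.ratio π θ i k ≤ W.w i k * C :=
      mul_le_mul_of_nonneg_left (ratio_le hπ hB G hC θ hik) (W.w i k).coe_nonneg
    have h3 : 0 ≤ W.w k i * G.ratio π θ k i :=
      mul_nonneg (W.w k i).coe_nonneg (ratio_nonneg hπ hB G θ k i)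
    have h4 : 0 ≤ W.w i k * G.ratio π θ i k :=
      mul_nonneg (W.w i k).coe_nonneg (ratio_nonneg hπ hB G θ i k)
    rw [abs_le]
    constructor <;> simp only [hX] <;> linarith
  have h0 := hs θ k
  rw [← Finset.add_sum_erase _ _ (Finset.mem_univ j), if_pos h.ne] at h0
  have hfj : diffPDF π (θ k - θ j) = f := by
    rw [hθ, h.right, spread_left, sub_zero, diffPDF_neg]
  have hfi : ∀ i, i ≠ j → i ≠ k → diffPDF π (θ k - θ i) ≤ ε / (S + 1) * f := by
    intro i hij hik
    rw [hθ, h.right]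
    rcases h.cases T i with ⟨h1, -⟩ | ⟨h1, -⟩ | ⟨-, -, -, -, h5⟩ | ⟨-, -, -, -, h5⟩ |
      ⟨-, -, -, -, h5⟩
    · exact absurd h1 hij
    · exact absurd h1 hik
    · have := hT₀ T hTT 0
      rw [h5, ← diffPDF_neg]
      convert this using 2
      push_cast; ring
    · have := hT₀ T hTT (T - 1)
      rw [h5, ← diffPDF_neg]
      convert this using 2
      push_cast [Nat.cast_sub (show 1 ≤ T by lia)]; ring
    · have := hT₀ T hTT (T - 1)
      rw [h5]
      convert this using 2
      push_cast [Nat.cast_sub (show 1 ≤ T by lia)]; ring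
  have hrest : |∑ i ∈ Finset.univ.erase j, (if i ≠ k then diffPDF π (θ k - θ i) *
      (W.w k i * G.ratio π θ k i - W.w i k * G.ratio π θ i k) else 0)| ≤
      ε / (S + 1) * f * S := by
    refine (Finset.abs_sum_le_sum_abs _ _).trans ?_
    rw [hS, Finset.mul_sum]
    refine (Finset.sum_le_sum fun i hi => ?_).trans
      (Finset.sum_le_sum_of_subset_of_nonneg (Finset.erase_subset _ _) fun i _ _ => by positivity)
    split_ifs with hik
    · rw [abs_mul, abs_of_pos (diffPDF_pos hπ hB _)]
      exact mul_le_mul (hfi i (Finset.ne_of_mem_erase hi) hik) (hXb i hik) (abs_nonneg _)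
        (by positivity)
    · rw [abs_zero]; positivity
  have h1 : |f * X j| ≤ ε / (S + 1) * f * S := by
    rw [hfj] at h0
    change f * X j + _ = 0 at h0
    rw [eq_neg_of_add_eq_zero_left h0, abs_neg]
    exact hrest
  rw [abs_mul, abs_of_pos hf0] at h1
  rw [Real.dist_eq, sub_zero]
  change |X j| < ε
  have h2 : f * |X j| < f * ε := by
    refine h1.trans_lt ?_
    have : ε / (S + 1) * S < ε := by
      rw [div_mul_eq_mul_div, div_lt_iff₀ (by positivity)]; nlinarith
    calc ε / (S + 1) * f * S = f * (ε / (S + 1) * S) := by ring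
      _ < f * ε := mul_lt_mul_of_pos_left this hf0
  exact lt_of_mul_lt_mul_left h2 hf0.le

lemma IsSpread.weight_identity (hπ : IsUtilityDensity π) (hsymm : ∀ x, π (-x) = π x)
    {B : ℝ} (hB : ∀ x, π x ≤ B)
    (hdiff : Differentiable ℝ π) (hlim : Tendsto (deriv fun x => Real.log (π x)) atBot atTop)
    (h : IsSpread j k A D) {G : Breaking m} {W : CMLWeights m} (hs : Stationary π G W) :
    W.w k j * G.gNat (A.card + D.card) (A.card + D.card + 1) =
      W.w j k * ∫ x, G.gNat (D.card + nearCount j A x) (A.card + D.card + 1)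
        ∂(noiseLaw m π) := by
  have := isProbabilityMeasure_noise hπ
  have h1 := ((h.tendsto_ratio_rare hπ hsymm hB hdiff hlim G).const_mul (W.w k j : ℝ)).sub
    ((h.tendsto_ratio_typical (π := π) G).const_mul (W.w j k : ℝ))
  exact sub_eq_zero.1 (tendsto_nhds_unique h1
    (h.tendsto_stationary hπ hsymm hB hdiff hlim hs))

end Spread

/-! ### Uniformity and symmetry from the weight identities. -/

lemma exists_isSpread {j k : Fin m} (hjk : j ≠ k) {r s : ℕ} (hrs : r ≤ s) (hs : s + 2 ≤ m) :
    ∃ A D : Finset (Fin m), IsSpread j k A D ∧ A.card = r ∧ D.card = s - r := by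
  have hcard : ((Finset.univ.erase j).erase k).card = m - 2 := by
    rw [Finset.card_erase_of_mem (by simp [hjk.symm]), Finset.card_erase_of_mem (by simp),
      Finset.card_fin]
    lia
  obtain ⟨S, hS, hSc⟩ := Finset.exists_subset_card_eq (s := (Finset.univ.erase j).erase k)
    (n := s) (by lia)
  obtain ⟨A, hA, hAc⟩ := Finset.exists_subset_card_eq (s := S) (n := r) (by lia)
  have hjS : j ∉ S := fun h => by simpa using hS h
  have hkS : k ∉ S := fun h => by simpa using hS h
  refine ⟨A, S \ A, ⟨hjk, fun h => hjS (hA h), fun h => hjS (Finset.mem_sdiff.1 h).1,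
    fun h => hkS (hA h), fun h => hkS (Finset.mem_sdiff.1 h).1, Finset.disjoint_sdiff⟩, hAc, ?_⟩
  rw [Finset.card_sdiff_of_subset hA, hSc, hAc]

lemma noiseLaw_nearCount_zero_pos (hπ : IsUtilityDensity π) {j : Fin m} {A : Finset (Fin m)}
    (hj : j ∉ A) : 0 < (noiseLaw m π).real {x | nearCount j A x = 0} := by
  have := isProbabilityMeasure_noise hπ
  have hsub : Set.pi Set.univ (fun i : Fin m => if i = j then Set.Ioi (1 : ℝ) else Set.Iio 0) ⊆
      {x | nearCount j A x = 0} := by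
    intro x hx
    simp only [Set.mem_pi, Set.mem_univ, forall_const] at hx
    have hxj := hx j
    rw [if_pos rfl] at hxj
    rw [Set.mem_ofPred_eq, nearCount, Finset.card_eq_zero, Finset.filter_eq_empty_iff]
    intro i hi
    have hxi := hx i
    rw [if_neg (ne_of_mem_of_not_mem hi hj)] at hxi
    simp only [Set.mem_Ioi, Set.mem_Iio] at hxi hxj
    linarith
  refine ENNReal.toReal_pos (lt_of_lt_of_le ?_ (measure_mono hsub)).ne' (measure_ne_top _ _)
  rw [noiseLaw, Measure.pi_pi]
  refine CanonicallyOrderedAdd.prod_pos.2 fun i _ => ?_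
  split_ifs
  · exact noise_pos_of_isOpen hπ isOpen_Ioi ⟨2, by simp⟩
  · exact noise_pos_of_isOpen hπ isOpen_Iio ⟨-1, by simp⟩

section Columns

variable {B : ℝ} {G : Breaking m} {W : CMLWeights m}

/-- With A empty, j sits directly above k in the typical order too, so both sides carry the same
breaking weight. -/
lemma Stationary.weight_comm (hs : Stationary π G W) (hπ : IsUtilityDensity π)
    (hsymm : ∀ x, π (-x) = π x) (hB : ∀ x, π x ≤ B) (hdiff : Differentiable ℝ π)
    (hlim : Tendsto (deriv fun x => Real.log (π x)) atBot atTop) {j k : Fin m} (hjk : j ≠ k)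
    {s : ℕ} (hsm : s + 2 ≤ m) : W.w k j * G.gNat s (s + 1) = W.w j k * G.gNat s (s + 1) := by
  have := isProbabilityMeasure_noise hπ
  obtain ⟨A, D, h, hA, hD⟩ := exists_isSpread hjk s.zero_le hsm
  have h1 := h.weight_identity hπ hsymm hB hdiff hlim hs
  rw [Finset.card_eq_zero] at hA
  subst hA
  simpa [nearCount, hD] using h1

/-- Induction on r = |A|: when some alternative of A beats j, the value is known from smaller r. The
remaining case, none above j, has positive probability and can be solved for. -/
lemma Stationary.weight_mul_gNat (hs : Stationary π G W) (hπ : IsUtilityDensity π)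
    (hsymm : ∀ x, π (-x) = π x) (hB : ∀ x, π x ≤ B) (hdiff : Differentiable ℝ π)
    (hlim : Tendsto (deriv fun x => Real.log (π x)) atBot atTop) {j k : Fin m} (hjk : j ≠ k)
    {s : ℕ} (hsm : s + 2 ≤ m) (r : ℕ) (hr : r ≤ s) :
    W.w j k * G.gNat (s - r) (s + 1) = W.w j k * G.gNat s (s + 1) := by
  have := isProbabilityMeasure_noise hπ
  induction r using Nat.strong_induction_on with
  | _ r ih =>
    obtain ⟨A, D, h, hA, hD⟩ := exists_isSpread hjk hr hsm
    have h1 := h.weight_identity hπ hsymm hB hdiff hlim hs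
    have hcard : A.card + D.card = s := by lia
    rw [hcard, hD, hs.weight_comm hπ hsymm hB hdiff hlim hjk hsm, ← integral_const_mul] at h1
    have hpt : ∀ x, W.w j k * G.gNat (s - r + nearCount j A x) (s + 1) =
        W.w j k * G.gNat s (s + 1) + {x | nearCount j A x = 0}.indicator
          (fun _ => W.w j k * G.gNat (s - r) (s + 1) - W.w j k * G.gNat s (s + 1)) x := by
      intro x
      by_cases hx : nearCount j A x = 0
      · rw [Set.indicator_of_mem (by exact hx), hx]; simp
      · rw [Set.indicator_of_notMem (by exact hx), add_zero]
        have hle : nearCount j A x ≤ r := hA ▸ Finset.card_filter_le _ _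
        rw [← ih (r - nearCount j A x) (by lia) (by lia)]
        congr 2
        lia
    have hm : MeasurableSet {x | nearCount j A x = 0} :=
      measurable_nearCount j A (measurableSet_singleton 0)
    simp_rw [hpt] at h1
    rw [integral_add (integrable_const _) ((integrable_const _).indicator hm),
      integral_indicator_const _ hm, integral_const, probReal_univ, one_smul, left_eq_add,
      smul_eq_mul] at h1
    exact sub_eq_zero.1 ((mul_eq_zero.1 h1).resolve_left
      (noiseLaw_nearCount_zero_pos hπ h.left_notMem_near).ne')

/-- The weights of the breaking depend on the lower position only. -/
lemma Stationary.gNat_eq (hs : Stationary π G W) (hπ : IsUtilityDensity π)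
    (hsymm : ∀ x, π (-x) = π x) (hB : ∀ x, π x ≤ B) (hdiff : Differentiable ℝ π)
    (hlim : Tendsto (deriv fun x => Real.log (π x)) atBot atTop) {j k : Fin m} (hjk : j ≠ k)
    (hw : 0 < W.w j k) {a b : ℕ} (hab : a ≤ b) (hb : b + 1 < m) :
    G.gNat a (b + 1) = G.gNat b (b + 1) := by
  have h := hs.weight_mul_gNat hπ hsymm hB hdiff hlim hjk (s := b) (by lia) (b - a) (by lia)
  rw [Nat.sub_sub_self hab] at h
  exact mul_left_cancel₀ (NNReal.coe_pos.2 hw).ne' h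

end Columns

lemma gNat_rev (G : Breaking m) {a b : ℕ} (ha : a < m) (hb : b < m) :
    G.rev.gNat (m - 1 - b) (m - 1 - a) = G.gNat a b := by
  rw [Breaking.gNat, Breaking.gNat, dif_pos (by lia), dif_pos ⟨ha, hb⟩]
  simp only [Breaking.rev]
  congr 2 <;> ext <;> simp only [Fin.val_rev] <;> lia

/-- Columns are constant by the identities for `G`, and row 0 is constant because it is the last
column of `G.rev`. -/
lemma exists_gNat_const (hπ : IsUtilityDensity π) (hsymm : ∀ x, π (-x) = π x) {B : ℝ}
    (hB : ∀ x, π x ≤ B) (hdiff : Differentiable ℝ π)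
    (hlim : Tendsto (deriv fun x => Real.log (π x)) atBot atTop) {G : Breaking m}
    {W : CMLWeights m} (hs : Stationary π G W) {j k : Fin m} (hjk : j ≠ k) (hw : 0 < W.w j k)
    {a b : ℕ} (hab : a < b) (hb : b < m) : G.gNat a b = G.gNat 0 1 := by
  have hcol : ∀ {a b : ℕ}, a ≤ b → b + 1 < m → G.gNat a (b + 1) = G.gNat b (b + 1) :=
    fun h1 h2 => hs.gNat_eq hπ hsymm hB hdiff hlim hjk hw h1 h2
  have hrow : ∀ b, 0 < b → b < m → G.gNat 0 b = G.gNat 0 1 := by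
    intro b h0 hbm
    have h1 := (hs.rev hπ hsymm).gNat_eq hπ hsymm hB hdiff hlim hjk.symm
      (show 0 < W.swap.w k j from hw) (a := m - 1 - b) (b := m - 2) (by lia) (by lia)
    rw [← gNat_rev G (a := 0) (b := b) (by lia) hbm, ← gNat_rev G (a := 0) (b := 1) (by lia)
      (by lia)]
    convert h1 using 2 <;> lia
  obtain ⟨c, rfl⟩ : ∃ c, b = c + 1 := ⟨b - 1, by lia⟩
  -- The chain is g(a,c+1) = g(c,c+1) = g(0,c+1) = g(0,1).
  rw [hcol (by lia) hb, ← hcol c.zero_le hb, hrow _ (by lia) hb]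

end

end RBCML

theorem mainTheorem2 {m : ℕ} (π : ℝ → ℝ) (hπ : RBCML.IsUtilityDensity π)
    (hsymm : ∀ x, π (-x) = π x)
    (hdiff : Differentiable ℝ π)
    (hanti : Antitone (deriv fun x => Real.log (π x)))
    (hlim : Tendsto (deriv fun x => Real.log (π x)) atBot atTop)
    (G : RBCML.Breaking m) (hG : G.HasEdge) (W : RBCML.CMLWeights m) :
    RBCML.IsConsistent (fun _ : Fin m => π) G W ↔
      G.Uniform ∧ W.Connected ∧ W.Symmetric := by
  open RBCML in
  obtain ⟨k₀, l₀, hkl, hg⟩ := hG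
  have hm : 1 < m := by have := l₀.isLt; have : k₀.val < l₀.val := hkl; lia
  have hB := density_le_zero hπ hsymm hdiff hanti
  constructor
  · intro h
    have hconn := connected_of_isConsistent (by lia) hπ h
    have hs := stationary_of_isConsistent (by lia) hπ hB h
    obtain ⟨j, k, hjk, hw⟩ : ∃ j k, j ≠ k ∧ 0 < W.w j k := by
      have : Nontrivial (Fin m) := Fin.nontrivial_iff_two_le.2 hm
      obtain ⟨b, hb⟩ := hconn.preconnected.exists_adj_of_nontrivial (⟨0, by lia⟩ : Fin m)
      rw [SimpleGraph.fromRel_adj] at hb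
      rcases hb.2 with h | h
      · exact ⟨_, _, hb.1, h⟩
      · exact ⟨_, _, hb.1.symm, h⟩
    have hval : ∀ k l : Fin m, k < l → (G.g k l : ℝ) = G.gNat 0 1 := by
      intro a b hab
      rw [← exists_gNat_const hπ hsymm hB hdiff hlim hs hjk hw hab b.isLt, Breaking.gNat,
        dif_pos ⟨a.isLt, b.isLt⟩]
    have h01 : 0 < G.gNat 0 1 := hval _ _ hkl ▸ NNReal.coe_pos.2 hg
    refine ⟨fun a b c d hab hcd => NNReal.coe_injective ((hval a b hab).trans (hval c d hcd).symm),
      hconn, fun i l hil => NNReal.coe_injective ?_⟩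
    -- The common weight is positive, so the case s = 0 gives symmetry for every pair.
    exact mul_right_cancel₀ h01.ne' (hs.weight_comm hπ hsymm hB hdiff hlim hil.symm (s := 0) hm)
  · rintro ⟨hu, hconn, hsym⟩
    exact isConsistent_of_uniform (by lia) hπ hB G (NNReal.coe_pos.2 hg)
      (fun k l h => by rw [hu k l k₀ l₀ h hkl]) W hconn hsym
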